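/- Let $p$ be a prime, let $\mathbb{C}_p$ be the completion of an algebraic closure of $\mathbb{Q}_p$, with absolute value $|\cdot|$, ring of integers $\mathfrak{o}=\{x\in\mathbb{C}_p : |x|\le 1\}$ and residue field $k$. Let $g\ge 0$, let $V$ be a subvariety (a Zariski closed subset, possibly reducible) of $(\mathbb{P}^1)^g$ defined over $\mathbb{C}_p$, and let $f_1,\dots,f_g\in\mathbb{C}_p(t)$ be rational functions of good reduction: each $f_i$, viewed as a self-map of $\mathbb{P}^1$, can be written $[X:Y]\mapsto[F_i(X,Y):G_i(X,Y)]$ with $F_i,G_i\in\mathfrak{o}[X,Y]$ relatively prime homogeneous polynomials of the same degree, at least one of whose coefficients is a unit of $\mathfrak{o}$, such that the reductions of $F_i$ and $G_i$ in $k[X,Y]$ are relatively prime (so that they define a morphism $\mathbb{P}^1\to\mathbb{P}^1$ over $k$ of the same degree as $f_i$). Let $\Phi$ be the coordinatewise action of $(f_1,\dots,f_g)$ on $(\mathbb{P}^1)^g$, let $\alpha=(x_1,\dots,x_g)\in(\mathbb{P}^1(\mathbb{C}_p))^g$, and let $\mathcal{O}=\{\Phi^n(\alpha): n\ge 0\}$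 be its orbit. A periodic point $z\in\mathbb{P}^1(\mathbb{C}_p)$ of $f_i$ with exact period $n\ge 1$ is attracting if its multiplier $\lambda=(f_i^n)'(z)$ (computed after a change of coordinates if $z=\infty$) satisfies $|\lambda|<1$. The residue class of a point of $\mathbb{P}^1(\mathbb{C}_p)$ is the set of all points having the same image under the reduction map $\mathbb{P}^1(\mathbb{C}_p)\to\mathbb{P}^1(k)$. Suppose that for each $i$ the orbit $\{f_i^n(x_i): n\ge 0\}$ does not intersect the residue class of any attracting periodic point of $f_i$. Then $V(\mathbb{C}_p)\cap\mathcal{O}$ is a union of at most finitely many orbits of the form $\{\Phi^{nk+\ell}(\alpha)\}_{n\ge 0}$ with $k,\ell$ nonnegative integers. -/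

import Mathlib

namespace DynP1

open scoped LinearAlgebra.Projectivization

section Maps

variable {K : Type*} [Field K]

/-- The projective line over `K`, as the set of lines in `K²`. The point `[x : y]` is the class of
`![x, y]`; the affine point `t` is `[t : 1]` and `∞` is `[1 : 0]`. -/
abbrev P1 (K : Type*) [Field K] : Type _ := ℙ K (Fin 2 → K)

/-- The degree of a rational function, `max (deg num) (deg denom)` in lowest terms. -/
noncomputable def ratDegree (f : RatFunc K) : ℕ :=
  max f.num.natDegree f.denom.natDegree

/-- The form `F(X, Y) = Y ^ d * num(X / Y)`, where `d` is the degree of `f`. -/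
noncomputable def homNum (f : RatFunc K) : MvPolynomial (Fin 2) K :=
  f.num.homogenize (ratDegree f)

/-- The form `G(X, Y) = Y ^ d * denom(X / Y)`, where `d` is the degree of `f`. -/
noncomputable def homDenom (f : RatFunc K) : MvPolynomial (Fin 2) K :=
  f.denom.homogenize (ratDegree f)

/-- The map `(x, y) ↦ (F(x, y), G(x, y))` on `K²` given by the forms of `f`. -/
noncomputable def homLift (f : RatFunc K) (v : Fin 2 → K) : Fin 2 → K :=
  ![MvPolynomial.eval v (homNum f), MvPolynomial.eval v (homDenom f)]

theorem eval_homogenize_of_eq_zero (q : Polynomial K) (d : ℕ) (v : Fin 2 → K) (hv : v 1 = 0) :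
    MvPolynomial.eval v (q.homogenize d) = q.coeff d * v 0 ^ d := by
  rw [Polynomial.homogenize, map_sum, Finset.sum_eq_single (d, 0)]
  · simp [MvPolynomial.eval_monomial, Finsupp.prod_fintype, Fin.prod_univ_two]
  · rintro ⟨a, b⟩ hab hne
    have hb : b ≠ 0 := by
      rintro rfl
      simp at hab
      exact hne (by simp [hab])
    simp [MvPolynomial.eval_monomial, Finsupp.prod_fintype, Fin.prod_univ_two, hv, hb]
  · simp

theorem homLift_ne_zero (f : RatFunc K) (v : Fin 2 → K) (hv : v ≠ 0) : homLift f v ≠ 0 := by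
  intro h
  have h0 : MvPolynomial.eval v (homNum f) = 0 := by simpa [homLift] using congrFun h 0
  have h1 : MvPolynomial.eval v (homDenom f) = 0 := by simpa [homLift] using congrFun h 1
  by_cases hy : v 1 = 0
  · have hx : v 0 ≠ 0 := fun hx => hv (by ext i; fin_cases i <;> simp [hx, hy])
    rw [homNum, eval_homogenize_of_eq_zero _ _ _ hy] at h0
    rw [homDenom, eval_homogenize_of_eq_zero _ _ _ hy] at h1
    have h0' : f.num.coeff (ratDegree f) = 0 := by simpa [hx] using h0
    have h1' : f.denom.coeff (ratDegree f) = 0 := by simpa [hx] using h1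
    rcases le_total f.num.natDegree f.denom.natDegree with hle | hle
    · rw [ratDegree, max_eq_right hle] at h1'
      exact f.denom_ne_zero (Polynomial.leadingCoeff_eq_zero.1 h1')
    · rw [ratDegree, max_eq_left hle] at h0'
      have hn : f.num = 0 := Polynomial.leadingCoeff_eq_zero.1 h0'
      have hf : f = 0 := RatFunc.num_eq_zero_iff.1 hn
      subst hf
      simp [ratDegree] at h1'
  · rw [homNum, Polynomial.eval_homogenize (n := ratDegree f) (le_max_left _ _) _ hy] at h0
    rw [homDenom, Polynomial.eval_homogenize (n := ratDegree f) (le_max_right _ _) _ hy] at h1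
    have h0' : f.num.eval (v 0 / v 1) = 0 := by simpa [hy] using h0
    have h1' : f.denom.eval (v 0 / v 1) = 0 := by simpa [hy] using h1
    obtain ⟨a, b, hab⟩ := f.isCoprime_num_denom
    have := congrArg (Polynomial.eval (v 0 / v 1)) hab
    simp [h0', h1'] at this

/-- The action of a rational function on the projective line, `[x : y] ↦ [F(x, y) : G(x, y)]`.
As `F` and `G` are forms of the same degree, the choice of the representative is immaterial. -/
noncomputable def act (f : RatFunc K) (P : P1 K) : P1 K :=
  Projectivization.mk K (homLift f P.rep) (homLift_ne_zero f P.rep P.rep_nonzero)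

/-- The coordinatewise action of `(f₁, …, f_g)` on `(ℙ¹)^g`. -/
noncomputable def prodAct {g : ℕ} (f : Fin g → RatFunc K) (P : Fin g → P1 K) : Fin g → P1 K :=
  fun i => act (f i) (P i)

/-- The forward orbit of a point under a self-map. -/
def orbit {S : Type*} (φ : S → S) (x : S) : Set S :=
  Set.range fun n : ℕ => φ^[n] x

/-- Set of `K`-points of a subvariety of `(ℙ¹)^g` defined over the field `K`: the common zeros of a
family of polynomials in the variables `X_{i,0}, X_{i,1}` (the coordinates of the `i`-th factor),
each of them homogeneous of some degree `d i` in the `i`-th pair of variables, for every `i`.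
Neither irreducibility nor non-emptiness is required. -/
def IsSubvariety {g : ℕ} (V : Set (Fin g → P1 K)) : Prop :=
  ∃ S : Set (MvPolynomial (Fin g × Fin 2) K),
    (∀ F ∈ S, ∃ d : Fin g → ℕ,
      F.IsWeightedHomogeneous (fun ij : Fin g × Fin 2 => (Pi.single ij.1 1 : Fin g → ℕ)) d) ∧
    V = {P | ∀ F ∈ S, MvPolynomial.eval (fun ij : Fin g × Fin 2 => (P ij.1).rep ij.2) F = 0}

end Maps

section Reduction

variable {K : Type*} [Field K] (A : ValuationSubring K)

/-- Good reduction with respect to the valuation ring `A` of `K`: `f = [F : G]` where `F`, `G`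
(a common multiple of the coprime forms of `f`) have coefficients in `A`, at least one of which is a
unit, and the reductions of `F` and `G` to the residue field are relatively prime, that is, they
define a morphism of the same degree as `f`. -/
def HasGoodReduction (f : RatFunc K) : Prop :=
  ∃ (c : K) (F G : MvPolynomial (Fin 2) A), c ≠ 0 ∧
    MvPolynomial.map (algebraMap A K) F = MvPolynomial.C c * homNum f ∧
    MvPolynomial.map (algebraMap A K) G = MvPolynomial.C c * homDenom f ∧
    (∃ m, IsUnit (F.coeff m) ∨ IsUnit (G.coeff m)) ∧
    IsRelPrime (MvPolynomial.map (IsLocalRing.residue A) F)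
      (MvPolynomial.map (IsLocalRing.residue A) G)

/-- The graph of the reduction map `ℙ¹(K) → ℙ¹(k)`, with `k` the residue field of `A`: the reduction
of `P = [x : y]`, with `x`, `y` in `A` not both in the maximal ideal, is `[x̄ : ȳ]`. -/
def ReducesTo (P : P1 K) (Q : P1 (IsLocalRing.ResidueField A)) : Prop :=
  ∃ (w : Fin 2 → A) (hw : (fun j => (w j : K)) ≠ 0)
    (hw' : (fun j => IsLocalRing.residue A (w j)) ≠ 0),
    P = Projectivization.mk K (fun j => (w j : K)) hw ∧
    Q = Projectivization.mk (IsLocalRing.ResidueField A) (fun j => IsLocalRing.residue A (w j)) hw'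

/-- Two points of `ℙ¹(K)` lie in the same residue class if they have the same reduction. -/
def SameResidueClass (P P' : P1 K) : Prop :=
  ∃ Q : P1 (IsLocalRing.ResidueField A), ReducesTo A P Q ∧ ReducesTo A P' Q

end Reduction

section Multiplier

variable {K : Type*} [NontriviallyNormedField K]

/-- The point `[t : 1]`. -/
noncomputable def affinePoint (t : K) : P1 K :=
  Projectivization.mk K ![t, 1] (fun h => one_ne_zero (congrFun h 1))

/-- The point `[1 : s]`. -/
noncomputable def affinePointInfty (s : K) : P1 K :=
  Projectivization.mk K ![1, s] (fun h => one_ne_zero (congrFun h 0))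

/-- The coordinate `x / y` of `[x : y]`, meaningful away from `∞ = [1 : 0]`. -/
noncomputable def coord (P : P1 K) : K := P.rep 0 / P.rep 1

/-- The coordinate `y / x` of `[x : y]`, meaningful away from `[0 : 1]`. -/
noncomputable def coordInfty (P : P1 K) : K := P.rep 1 / P.rep 0

open Classical in
/-- The multiplier of a periodic point `z` of `f` of exact period `n`: the derivative at `z` of the
`n`-th iterate, taken in the coordinate `x / y` if `z ≠ ∞` and in the coordinate `y / x` if
`z = ∞`. -/
noncomputable def multiplier (f : RatFunc K) (z : P1 K) : K :=
  let n := Function.minimalPeriod (act f) z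
  if z.rep 1 = 0 then
    deriv (fun s : K => coordInfty ((act f)^[n] (affinePointInfty s))) (coordInfty z)
  else
    deriv (fun t : K => coord ((act f)^[n] (affinePoint t))) (coord z)

/-- `z` is a periodic point of `f` whose multiplier has absolute value less than one. -/
def IsAttractingPeriodic (f : RatFunc K) (z : P1 K) : Prop :=
  z ∈ Function.periodicPts (act f) ∧ ‖multiplier f z‖ < 1

end Multiplier

end DynP1

/-! Good reduction gives each `f i` a homogeneous lift over the valuation ring which also acts on
the plane over the residue field. That field is algebraic over its prime field, so the reduced orbit
of a vector stays in a finite ring and is eventually periodic: some iterate `f^N` maps the residue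
class of an orbit point `[w]` into itself. In the coordinate `t` of `[w + t e]` this iterate is a
quotient `h = U / L` of integral polynomials (`IsGoodLift.exists_chart`). If the linear coefficient
of `U` were not a unit, `h` would contract a closed disc of radius less than one and have an
attracting fixed point there, which is excluded.

With a unit linear coefficient, `h` read on a small disc `t = π u` is affine modulo `π`, with linear
coefficient of finite order, so a suitable iterate is the identity modulo any prescribed power of
`π` (`exists_diffBounded_iterate`). Along a progression of times the homogeneous coordinates then
have `j`-th differences bounded by `C * |p| ^ (2 * j)`. As `|j!| ≥ |p| ^ j`, their expansions in
falling factorials have coefficients tending to zero, and such a sequence with infinitely many zeros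
is zero (`DiffBounded.eq_zero_of_infinite_zeros`), as in the Skolem–Mahler–Lech theorem.

Difference bounds survive sums and products, so they pass to every equation of `V` along a
progression common to all factors. On each such progression the orbit lies in `V` always or only
finitely often; the finitely many leftover times are progressions with `k = 0`. -/

namespace DynP1

open Finset Polynomial

/-! ### Sequences with small differences and their zeros -/

section Sequences

variable {K : Type*} [NormedField K]

/-- Sequences whose `j`-th differences are bounded by a constant times `ε ^ j`. -/
def DiffBounded (ε : ℝ) (a : ℕ → K) : Prop :=
  ∃ C : ℝ, 0 ≤ C ∧ ∀ j n, ‖(fwdDiff 1)^[j] a n‖ ≤ C * ε ^ j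

theorem DiffBounded.const {ε : ℝ} (hε : 0 ≤ ε) (c : K) : DiffBounded ε fun _ => c := by
  refine ⟨‖c‖, norm_nonneg _, fun j n => ?_⟩
  cases j with
  | zero => simp
  | succ j =>
    rw [Function.iterate_succ_apply, fwdDiff_const]
    have : ∀ i, ((fwdDiff 1)^[i] fun _ : ℕ => (0 : K)) = fun _ => 0 := by
      intro i
      induction i with
      | zero => rfl
      | succ i ih => rw [Function.iterate_succ_apply, fwdDiff_const, ih]
    rw [this, norm_zero]
    positivity

/-- The exponent of `p` in `j!` is at most `j`. This crude bound explains the choice `ε ≤ |p| ^ 2`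
below: one factor `|p| ^ j` pays for `j!`, the other gives convergence. -/
theorem pow_le_norm_factorial {p : ℕ} [hp : Fact p.Prime] (hpK : ∀ m : ℕ, ¬ p ∣ m → ‖(m : K)‖ = 1)
    (hp1 : ‖(p : K)‖ ≤ 1) (j : ℕ) : ‖(p : K)‖ ^ j ≤ ‖((j.factorial : ℕ) : K)‖ := by
  obtain ⟨e, m, hm, he⟩ := Nat.exists_eq_pow_mul_and_not_dvd j.factorial_ne_zero p
    hp.out.ne_one
  have hej : e ≤ j := by
    have := padicValNat_factorial_le (p := p) j
    rwa [he, padicValNat.mul (pow_ne_zero _ hp.out.ne_zero) (by rintro rfl; simp at hm),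
      padicValNat.prime_pow, padicValNat.eq_zero_of_not_dvd hm, add_zero] at this
  rw [he]
  push_cast
  rw [norm_mul, norm_pow, hpK m hm, mul_one]
  exact pow_le_pow_of_le_one (norm_nonneg _) hp1 hej

variable [IsUltrametricDist K]

theorem DiffBounded.add {ε : ℝ} (hε : 0 ≤ ε) {a b : ℕ → K} (ha : DiffBounded ε a)
    (hb : DiffBounded ε b) : DiffBounded ε fun n => a n + b n := by
  obtain ⟨C, hC, ha⟩ := ha
  obtain ⟨C', hC', hb⟩ := hb
  refine ⟨max C C', le_max_of_le_left hC, fun j n => ?_⟩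
  have : (fun n => a n + b n) = a + b := rfl
  rw [this, fwdDiff_iter_add]
  refine (IsUltrametricDist.norm_add_le_max _ _).trans (max_le ?_ ?_)
  · exact (ha j n).trans (by gcongr; exact le_max_left _ _)
  · exact (hb j n).trans (by gcongr; exact le_max_right _ _)

/-- Induction on the Leibniz rule `Δ(ab)(n) = a(n+1) Δb(n) + Δa(n) b(n)`; the ultrametric inequality
removes binomial factors. The constants are quantified inside the induction because `Δa` and `Δb`
satisfy the same bounds with an extra factor `ε`. -/
theorem norm_fwdDiff_iter_mul_le {ε : ℝ} (hε : 0 ≤ ε) (j : ℕ) :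
    ∀ (a b : ℕ → K) (C C' : ℝ), 0 ≤ C → 0 ≤ C' → (∀ j n, ‖(fwdDiff 1)^[j] a n‖ ≤ C * ε ^ j) →
      (∀ j n, ‖(fwdDiff 1)^[j] b n‖ ≤ C' * ε ^ j) →
      ∀ n, ‖(fwdDiff 1)^[j] (fun n => a n * b n) n‖ ≤ C * C' * ε ^ j := by
  induction j with
  | zero =>
    intro a b C C' hC hC' ha hb n
    have h1 := ha 0 n
    have h2 := hb 0 n
    simp only [Function.iterate_zero, id_eq, pow_zero, mul_one, norm_mul] at *
    gcongr
  | succ j ih =>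
    intro a b C C' hC hC' ha hb n
    have key : fwdDiff 1 (fun n => a n * b n)
        = (fun n => a (n + 1) * fwdDiff 1 b n) + fun n => fwdDiff 1 a n * b n := by
      ext n
      simp only [fwdDiff, Pi.add_apply]
      ring
    rw [Function.iterate_succ_apply, key, fwdDiff_iter_add]
    have hs : ∀ j n, ‖(fwdDiff 1)^[j] (fun n => a (n + 1)) n‖ ≤ C * ε ^ j := fun j n => by
      rw [fwdDiff_iter_comp_add]
      exact ha j (n + 1)
    have ha' : ∀ j n, ‖(fwdDiff 1)^[j] (fwdDiff 1 a) n‖ ≤ (C * ε) * ε ^ j := fun j n => by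
      rw [← Function.iterate_succ_apply]
      exact (ha (j + 1) n).trans_eq (by ring)
    have hb' : ∀ j n, ‖(fwdDiff 1)^[j] (fwdDiff 1 b) n‖ ≤ (C' * ε) * ε ^ j := fun j n => by
      rw [← Function.iterate_succ_apply]
      exact (hb (j + 1) n).trans_eq (by ring)
    refine (IsUltrametricDist.norm_add_le_max _ _).trans (max_le ?_ ?_)
    · exact (ih _ _ C (C' * ε) hC (by positivity) hs hb' n).trans_eq (by ring)
    · exact (ih _ _ (C * ε) C' (by positivity) hC' ha' hb n).trans_eq (by ring)

theorem DiffBounded.mul {ε : ℝ} (hε : 0 ≤ ε) {a b : ℕ → K} (ha : DiffBounded ε a)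
    (hb : DiffBounded ε b) : DiffBounded ε fun n => a n * b n := by
  obtain ⟨C, hC, ha⟩ := ha
  obtain ⟨C', hC', hb⟩ := hb
  exact ⟨C * C', mul_nonneg hC hC', fun j =>
    norm_fwdDiff_iter_mul_le hε j a b C C' hC hC' ha hb⟩

theorem DiffBounded.eval {ε : ℝ} (hε : 0 ≤ ε) {σ : Type*}
    (F : MvPolynomial σ K) {v : ℕ → σ → K} (hv : ∀ i, DiffBounded ε fun n => v n i) :
    DiffBounded ε fun n => MvPolynomial.eval (v n) F := by
  induction F using MvPolynomial.induction_on with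
  | C c => simpa using DiffBounded.const hε c
  | add P Q hP hQ => simpa using hP.add hε hQ
  | mul_X P i hP => simpa using hP.mul hε (hv i)

theorem norm_eval_intPoly_le_one (q : ℤ[X]) (n : ℕ) :
    ‖((q.eval (n : ℤ) : ℤ) : K)‖ ≤ 1 := IsUltrametricDist.norm_intCast_le_one K _

/-- A sequence given by a Mahler-type expansion in falling factorials, with coefficients tending to
zero, vanishes as soon as it has infinitely many zeros. -/
theorem eq_zero_of_infinite_zeros_of_descPochhammer {a β : ℕ → K} {δ : ℕ → ℝ}
    (hδ : Filter.Tendsto δ Filter.atTop (nhds 0)) (hβ : ∀ k j, k ≤ j → ‖β j‖ ≤ δ k)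
    (ha : ∀ N n, n ≤ N →
      a n = ∑ j ∈ range (N + 1), β j * (((descPochhammer ℤ j).eval (n : ℤ) : ℤ) : K))
    [CharZero K] (hz : {n | a n = 0}.Infinite) (n : ℕ) : a n = 0 := by
  have key : ∀ k, ‖a n‖ ≤ δ k := by
    intro k
    obtain ⟨s, hs, hsk⟩ := hz.exists_subset_card_eq k
    -- `W` vanishes at `k` chosen zeros of the sequence. Since it is monic over `ℤ`, dividing
    -- falling factorials by it keeps integer coefficients, hence values of norm at most one at
    -- integers.
    set W : ℤ[X] := ∏ x ∈ s, (X - C (x : ℤ)) with hW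
    have hWm : W.Monic := monic_prod_of_monic _ _ fun x _ => monic_X_sub_C _
    have hWd : W.natDegree = k := by
      rw [hW, natDegree_prod_of_monic _ _ fun x _ => monic_X_sub_C _]
      simp only [natDegree_X_sub_C, sum_const, hsk, smul_eq_mul, mul_one]
    set N := max n (max k (s.sup id)) with hN
    have hkN : k ≤ N := (le_max_left _ _).trans (le_max_right _ _)
    let ι : ℤ →+* K := Int.castRingHom K
    let q : ℕ → ℤ[X] := fun j => descPochhammer ℤ j /ₘ W
    let P : K[X] := ∑ j ∈ range (N + 1), C (β j) * (descPochhammer ℤ j).map ι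
    let Q : K[X] := ∑ j ∈ range (N + 1), C (β j) * (q j).map ι
    let R : K[X] := ∑ j ∈ range (N + 1), C (β j) * (descPochhammer ℤ j %ₘ W).map ι
    have hP : P = W.map ι * Q + R := by
      simp only [P, Q, R, q, mul_sum, ← sum_add_distrib]
      refine sum_congr rfl fun j _ => ?_
      conv_lhs => rw [← modByMonic_add_div (descPochhammer ℤ j) W]
      rw [Polynomial.map_add, Polynomial.map_mul]
      ring
    have hcast : ∀ (f : ℤ[X]) (m : ℕ), (f.map ι).eval (m : K) = ((f.eval (m : ℤ) : ℤ) : K) := by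
      intro f m
      have : (m : K) = ι (m : ℤ) := by simp [ι]
      rw [this, eval_map, eval₂_at_apply]
      rfl
    have hPe : ∀ m ≤ N, P.eval (m : K) = a m := by
      intro m hm
      rw [ha N m hm]
      simp only [P, eval_finsetSum, eval_mul, eval_C, hcast]
    -- The remainder has degree below `k` and `k` distinct roots, so `a n = W(n) Q(n)`.
    have hR : R = 0 := by
      refine eq_zero_of_degree_lt_of_eval_finset_eq_zero (s.map ⟨fun m : ℕ => (m : K),
        Nat.cast_injective⟩) ?_ ?_
      · rw [card_map, hsk]
        refine (degree_sum_le _ _).trans_lt ?_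
        refine (Finset.sup_lt_iff (WithBot.bot_lt_coe k)).2 fun j _ => ?_
        rw [← smul_eq_C_mul]
        refine (degree_smul_le _ _).trans_lt (degree_map_le.trans_lt ?_)
        refine (degree_modByMonic_lt _ hWm).trans_eq ?_
        rw [degree_eq_natDegree hWm.ne_zero, hWd]
        rfl
      · intro x hx
        obtain ⟨m, hm, rfl⟩ := mem_map.1 hx
        simp only [Function.Embedding.coeFn_mk]
        have h1 : R = P - W.map ι * Q := by rw [hP]; ring
        have hmN : m ≤ N := (Finset.le_sup (f := id) hm).trans
          ((le_max_right _ _).trans (le_max_right _ _))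
        have h2 : W.eval (m : ℤ) = 0 := by
          rw [hW, eval_prod]
          exact prod_eq_zero hm (by simp)
        rw [h1, eval_sub, hPe m hmN, eval_mul, hcast, h2]
        simpa using hs hm
    rw [← hPe n (le_max_left _ _), hP, hR, add_zero, eval_mul, norm_mul, hcast]
    have hδ0 : 0 ≤ δ k := (norm_nonneg _).trans (hβ k k le_rfl)
    refine (mul_le_of_le_one_left (norm_nonneg _) (norm_eval_intPoly_le_one _ _)).trans ?_
    simp only [Q, eval_finsetSum, eval_mul, eval_C, hcast]
    refine IsUltrametricDist.norm_sum_le_of_forall_le_of_nonneg hδ0 fun j _ => ?_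
    -- The quotient of a falling factorial of degree below `k` is zero, so only coefficients `β j`
    -- with `k ≤ j` contribute.
    rcases lt_or_ge j k with hj | hj
    · have : q j = 0 := by
        refine (divByMonic_eq_zero_iff hWm).2 ?_
        rw [degree_eq_natDegree hWm.ne_zero, hWd]
        refine degree_le_natDegree.trans_lt ?_
        rw [descPochhammer_natDegree]
        exact_mod_cast hj
      simpa [this] using hδ0
    · rw [norm_mul]
      exact (mul_le_of_le_one_right (norm_nonneg _) (norm_eval_intPoly_le_one _ _)).trans
        (hβ k j hj)
  have := ge_of_tendsto' hδ key
  exact norm_le_zero_iff.1 this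

/-- Newton's formula expands `a` in falling factorials with coefficients `Δ^j a(0) / j!`, of norm at
most `C * |p| ^ j`. -/
theorem DiffBounded.eq_zero_of_infinite_zeros [CharZero K] {p : ℕ} [hp : Fact p.Prime]
    (hpK : ∀ m : ℕ, ¬ p ∣ m → ‖(m : K)‖ = 1) (hp1 : ‖(p : K)‖ < 1) {ε : ℝ} (hε0 : 0 ≤ ε)
    (hε : ε ≤ ‖(p : K)‖ ^ 2) {a : ℕ → K} (ha : DiffBounded ε a) (hz : {n | a n = 0}.Infinite)
    (n : ℕ) : a n = 0 := by
  obtain ⟨C, hC, ha⟩ := ha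
  have hp0 : 0 < ‖(p : K)‖ := norm_pos_iff.2 (by exact_mod_cast hp.out.ne_zero)
  refine eq_zero_of_infinite_zeros_of_descPochhammer (a := a)
    (β := fun j => (fwdDiff 1)^[j] a 0 / (j.factorial : K)) (δ := fun k => C * ‖(p : K)‖ ^ k) ?_ ?_ ?_
    hz n
  · simpa using (tendsto_pow_atTop_nhds_zero_of_lt_one hp0.le hp1).const_mul C
  · intro k j hkj
    have hf := pow_le_norm_factorial hpK hp1.le j
    have hf0 : 0 < ‖((j.factorial : ℕ) : K)‖ := (pow_pos hp0 j).trans_le hf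
    rw [norm_div, div_le_iff₀ hf0]
    calc ‖(fwdDiff 1)^[j] a 0‖ ≤ C * ε ^ j := ha j 0
      _ ≤ C * (‖(p : K)‖ ^ 2) ^ j := by gcongr
      _ = C * ‖(p : K)‖ ^ j * ‖(p : K)‖ ^ j := by ring
      _ ≤ C * ‖(p : K)‖ ^ k * ‖((j.factorial : ℕ) : K)‖ :=
        mul_le_mul (mul_le_mul_of_nonneg_left
          (pow_le_pow_of_le_one hp0.le hp1.le hkj) hC) hf (by positivity) (by positivity)
  · intro N m hm
    have h := shift_eq_sum_fwdDiff_iter (1 : ℕ) a m 0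
    simp only [smul_eq_mul, mul_one, zero_add] at h
    rw [h]
    have hsub : range (m + 1) ⊆ range (N + 1) := range_subset_range.2 (by omega)
    have hterm : ∀ j, (m.choose j) • (fwdDiff 1)^[j] a 0
        = (fwdDiff 1)^[j] a 0 / (j.factorial : K) * (((descPochhammer ℤ j).eval (m : ℤ) : ℤ) : K) := by
      intro j
      have hf : ((j.factorial : ℕ) : K) ≠ 0 := by exact_mod_cast j.factorial_ne_zero
      rw [descPochhammer_eval_eq_descFactorial, Nat.descFactorial_eq_factorial_mul_choose]
      push_cast
      rw [nsmul_eq_mul]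
      field_simp
    rw [sum_subset hsub]
    · exact sum_congr rfl fun j _ => hterm j
    · intro j _ hj
      have : m < j := by simpa using hj
      simp [Nat.choose_eq_zero_of_lt this]

end Sequences

end DynP1

namespace DynP1

open Finset Polynomial

/-! ### Iterates of polynomials congruent to affine maps -/

section PolynomialIterates

variable {R : Type*} [CommRing R]

theorem C_dvd_comp_sub_comp {c : R} {P Q : R[X]} (h : C c ∣ P - Q) (F : R[X]) :
    C c ∣ F.comp P - F.comp Q := by
  have := sub_dvd_eval_sub P Q (F.map C)
  rw [eval_map, eval_map] at this
  exact h.trans this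

theorem C_dvd_comp_right {c : R} {P Q : R[X]} (h : C c ∣ P - Q) (F : R[X]) :
    C c ∣ P.comp F - Q.comp F := by
  obtain ⟨S, hS⟩ := h
  rw [← sub_comp, hS, mul_comp, C_comp]
  exact dvd_mul_right _ _

theorem C_dvd_C_of_dvd {a b : R} (h : a ∣ b) : C a ∣ (C b : R[X]) := map_dvd C h

/-- The `n`-th iterate of a polynomial under composition. -/
noncomputable def iterComp (φ : R[X]) (n : ℕ) : R[X] := φ.comp^[n] X

theorem iterComp_zero (φ : R[X]) : iterComp φ 0 = X := rfl

theorem iterComp_succ (φ : R[X]) (n : ℕ) : iterComp φ (n + 1) = φ.comp (iterComp φ n) := by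
  rw [iterComp, Function.iterate_succ_apply', iterComp]

theorem iterComp_add (φ : R[X]) (m n : ℕ) :
    iterComp φ (m + n) = (iterComp φ m).comp (iterComp φ n) := by
  induction m with
  | zero => simp [iterComp_zero]
  | succ m ih => rw [Nat.add_right_comm, iterComp_succ, ih, iterComp_succ, comp_assoc]

theorem iterComp_mul (φ : R[X]) (m n : ℕ) : iterComp φ (m * n) = iterComp (iterComp φ m) n := by
  induction n with
  | zero => rfl
  | succ n ih => rw [Nat.mul_succ, Nat.add_comm, iterComp_add, ih, iterComp_succ]

theorem aeval_iterComp {S : Type*} [CommRing S] [Algebra R S] (φ : R[X]) (n : ℕ) (x : S) :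
    aeval x (iterComp φ n) = (fun y => aeval y φ)^[n] x := by
  induction n with
  | zero => simp [iterComp_zero]
  | succ n ih => rw [iterComp_succ, aeval_comp, ih, Function.iterate_succ_apply']

theorem C_dvd_iterComp_sub_affine {c a b : R} {φ : R[X]} (h : C c ∣ φ - (C a * X + C b)) (n : ℕ) :
    C c ∣ iterComp φ n - (C (a ^ n) * X + C (b * ∑ i ∈ range n, a ^ i)) := by
  induction n with
  | zero => simp [iterComp_zero]
  | succ n ih =>
    have h1 := C_dvd_comp_right h (iterComp φ n)
    have h2 := (dvd_mul_of_dvd_right ih (C a))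
    have h3 := dvd_add h1 h2
    rw [iterComp_succ]
    convert h3 using 1
    rw [sum_range_succ', add_comp, mul_comp, C_comp, C_comp, X_comp]
    simp only [pow_succ, map_mul, map_add, map_sum, map_pow, ← sum_mul, pow_zero, map_one]
    ring

/-- Once `a ^ M` is `1` modulo `c`, the `M`-th iterate is a translation by some `b'`, and its `p`-th
iterate translates by `p b'`, which is zero modulo `c`. -/
theorem C_dvd_iterComp_sub_X_of_affine {c a b : R} {φ : R[X]} {p M : ℕ}
    (h : C c ∣ φ - (C a * X + C b)) (ha : c ∣ a ^ M - 1) (hp : c ∣ (p : R)) :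
    C c ∣ iterComp φ (M * p) - X := by
  set b' := b * ∑ i ∈ range M, a ^ i with hb'
  have h1 : C c ∣ iterComp φ M - (C 1 * X + C b') := by
    have h2 := dvd_mul_of_dvd_left (C_dvd_C_of_dvd ha) (X : R[X])
    convert dvd_add (C_dvd_iterComp_sub_affine h M) h2 using 1
    simp only [map_sub, map_pow, map_one]
    ring
  rw [iterComp_mul]
  have h3 := C_dvd_iterComp_sub_affine h1 p
  have h4 : C c ∣ C (b' * ∑ i ∈ range p, 1 ^ i) := by
    refine C_dvd_C_of_dvd ?_
    simpa using dvd_mul_of_dvd_right hp b'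
  convert dvd_add h3 h4 using 1
  simp only [one_pow, map_one]
  ring

/-- Write `φ = X + c^k e`. As `2k ≥ k + 1`, the correction `e` may be evaluated at `X` at every
step, so the `n`-th iterate is `X + n c^k e` modulo `c^(k+1)`; `n = p` gains the factor `c`. -/
theorem C_pow_succ_dvd_iterComp_sub_X {c : R} {φ : R[X]} {p k : ℕ} (hk : 1 ≤ k)
    (h : C (c ^ k) ∣ φ - X) (hp : c ∣ (p : R)) : C (c ^ (k + 1)) ∣ iterComp φ p - X := by
  obtain ⟨e, he⟩ := h
  have hφ : φ = X + C (c ^ k) * e := by rw [← he]; ring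
  have key : ∀ n : ℕ, C (c ^ (k + 1)) ∣ iterComp φ n - (X + (n : R[X]) * (C (c ^ k) * e)) := by
    intro n
    induction n with
    | zero => simp [iterComp_zero]
    | succ n ih =>
      have h1 : C (c ^ k) ∣ iterComp φ n - X := by
        have h0 : C (c ^ k) ∣ C (c ^ (k + 1)) := C_dvd_C_of_dvd (pow_dvd_pow _ (Nat.le_succ k))
        have h2 : C (c ^ k) ∣ (n : R[X]) * (C (c ^ k) * e) :=
          dvd_mul_of_dvd_right (dvd_mul_right _ _) _
        convert dvd_add (h0.trans ih) h2 using 1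
        ring
      have h2 := mul_dvd_mul (dvd_refl (C (c ^ k))) (C_dvd_comp_sub_comp h1 e)
      have h3 : C (c ^ (k + 1)) ∣ C (c ^ k) * C (c ^ k) := by
        rw [← C_mul, ← pow_add]
        exact C_dvd_C_of_dvd (pow_dvd_pow _ (by omega))
      rw [iterComp_succ]
      convert dvd_add ih (h3.trans h2) using 1
      conv_lhs => rw [hφ]
      rw [add_comp, X_comp, mul_comp, C_comp, comp_X, ← hφ]
      push_cast
      ring
  have h4 : C (c ^ (k + 1)) ∣ (p : R[X]) * (C (c ^ k) * e) := by
    have : C c ∣ ((p : ℕ) : R[X]) := by simpa using C_dvd_C_of_dvd hp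
    have h5 := dvd_mul_of_dvd_left (mul_dvd_mul this (dvd_refl (C (c ^ k)))) e
    rwa [← C_mul, ← pow_succ', mul_assoc] at h5
  convert dvd_add (key p) h4 using 1
  ring

/-- If `φ` is affine modulo `c`, with linear coefficient of finite order modulo `c`, then an
explicit iterate of `φ`, independent of `φ`, is the identity modulo `c ^ (s + 1)`. -/
theorem C_pow_dvd_iterComp_sub_X {c a b : R} {φ : R[X]} {p M : ℕ}
    (h : C c ∣ φ - (C a * X + C b)) (ha : c ∣ a ^ M - 1) (hp : c ∣ (p : R)) (s : ℕ) :
    C (c ^ (s + 1)) ∣ iterComp φ (M * p * p ^ s) - X := by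
  induction s with
  | zero => simpa using C_dvd_iterComp_sub_X_of_affine h ha hp
  | succ s ih =>
    rw [pow_succ p s, ← mul_assoc, iterComp_mul]
    exact C_pow_succ_dvd_iterComp_sub_X (by omega) ih hp

/-- Since `P ∘ ψ - P` is `c` times a polynomial, each difference along the orbit of `ψ` extracts one
factor `c` and leaves values of another polynomial over `R`. -/
theorem exists_fwdDiff_iter_aeval_eq {S : Type*} [CommRing S] [Algebra R S] {c : R} {ψ : R[X]}
    (h : C c ∣ ψ - X) (u : S) (j : ℕ) : ∀ P : R[X], ∃ Q : R[X],
      ∀ n, (fwdDiff 1)^[j] (fun n : ℕ => aeval ((fun y => aeval y ψ)^[n] u) P) n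
        = algebraMap R S c ^ j * aeval ((fun y => aeval y ψ)^[n] u) Q := by
  induction j with
  | zero => exact fun P => ⟨P, fun n => by simp⟩
  | succ j ih =>
    intro P
    have h1 := C_dvd_comp_sub_comp h P
    rw [comp_X] at h1
    obtain ⟨P', hP'⟩ := h1
    obtain ⟨Q, hQ⟩ := ih P'
    refine ⟨Q, fun n => ?_⟩
    have h2 : fwdDiff 1 (fun n : ℕ => aeval ((fun y => aeval y ψ)^[n] u) P)
        = algebraMap R S c • fun n : ℕ => aeval ((fun y => aeval y ψ)^[n] u) P' := by
      ext n
      have h3 := congrArg (aeval ((fun y => aeval y ψ)^[n] u)) hP'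
      rw [map_sub, aeval_comp, map_mul, aeval_C] at h3
      simp only [fwdDiff, Function.iterate_succ_apply', Pi.smul_apply, smul_eq_mul]
      exact h3
    rw [Function.iterate_succ_apply, h2, fwdDiff_iter_const_smul, Pi.smul_apply, hQ, smul_eq_mul,
      pow_succ']
    ring

end PolynomialIterates

end DynP1

namespace DynP1

open Finset Polynomial

/-! ### Interpolating the orbit inside a disc -/

section Interpolation

variable {K : Type*} [NormedField K] {A : ValuationSubring K}

theorem norm_coe_le_one (hA : ∀ x : K, x ∈ A ↔ ‖x‖ ≤ 1) (x : A) : ‖(x : K)‖ ≤ 1 :=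
  (hA x).1 x.2

theorem dvd_iff_norm_le (hA : ∀ x : K, x ∈ A ↔ ‖x‖ ≤ 1) {x y : A} :
    x ∣ y ↔ ‖(y : K)‖ ≤ ‖(x : K)‖ := by
  constructor
  · rintro ⟨z, rfl⟩
    simpa using mul_le_of_le_one_right (norm_nonneg (x : K)) (norm_coe_le_one hA z)
  · intro h
    by_cases hx : (x : K) = 0
    · have hy : (y : K) = 0 := by simpa [hx] using h
      have : y = 0 := by ext; simpa using hy
      exact this ▸ dvd_zero x
    · refine ⟨⟨(y : K) / x, (hA _).2 ?_⟩, ?_⟩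
      · rw [norm_div]
        exact div_le_one_of_le₀ h (norm_nonneg _)
      · ext
        push_cast
        field_simp

theorem isUnit_iff_norm_eq_one (hA : ∀ x : K, x ∈ A ↔ ‖x‖ ≤ 1) {x : A} :
    IsUnit x ↔ ‖(x : K)‖ = 1 := by
  rw [isUnit_iff_dvd_one, dvd_iff_norm_le hA]
  simp only [OneMemClass.coe_one, norm_one]
  exact ⟨fun h => le_antisymm (norm_coe_le_one hA x) h, fun h => h.ge⟩

theorem mem_maximalIdeal_iff_norm_lt_one (hA : ∀ x : K, x ∈ A ↔ ‖x‖ ≤ 1) {x : A} :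
    x ∈ IsLocalRing.maximalIdeal A ↔ ‖(x : K)‖ < 1 := by
  rw [IsLocalRing.mem_maximalIdeal, mem_nonunits_iff, isUnit_iff_norm_eq_one hA]
  exact ⟨fun h => lt_of_le_of_ne (norm_coe_le_one hA x) h, fun h => h.ne⟩

theorem exists_common_dvd (hA : ∀ x : K, x ∈ A ↔ ‖x‖ ≤ 1) {x y : A} (hx0 : x ≠ 0)
    (hx : ‖(x : K)‖ < 1) (hy : ‖(y : K)‖ < 1) :
    ∃ z : A, z ≠ 0 ∧ ‖(z : K)‖ < 1 ∧ z ∣ x ∧ z ∣ y := by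
  rcases le_total ‖(y : K)‖ ‖(x : K)‖ with h | h
  · exact ⟨x, hx0, hx, dvd_rfl, (dvd_iff_norm_le hA).2 h⟩
  · refine ⟨y, ?_, hy, (dvd_iff_norm_le hA).2 h, dvd_rfl⟩
    rintro rfl
    exact hx0 (by ext; simpa using h)

theorem aeval_coe (P : A[X]) (x : A) : aeval (x : K) P = ((P.eval x : A) : K) :=
  aeval_algebraMap_apply K x P

theorem norm_aeval_le_one (hA : ∀ x : K, x ∈ A ↔ ‖x‖ ≤ 1) (P : A[X]) {x : K} (hx : ‖x‖ ≤ 1) :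
    ‖aeval x P‖ ≤ 1 := by
  lift x to A using (hA x).2 hx
  rw [aeval_coe]
  exact norm_coe_le_one hA _

theorem norm_aeval_sub_le (hA : ∀ x : K, x ∈ A ↔ ‖x‖ ≤ 1) (P : A[X]) {x y : K} (hx : ‖x‖ ≤ 1)
    (hy : ‖y‖ ≤ 1) : ‖aeval x P - aeval y P‖ ≤ ‖x - y‖ := by
  lift x to A using (hA x).2 hx
  lift y to A using (hA y).2 hy
  rw [aeval_coe, aeval_coe]
  exact_mod_cast (dvd_iff_norm_le hA).1 (sub_dvd_eval_sub x y P)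

variable [IsUltrametricDist K]

theorem norm_fwdDiff_iter_le {δ : ℝ} (j : ℕ) : ∀ a : ℕ → K, (∀ n, ‖a n‖ ≤ δ) →
    ∀ n, ‖(fwdDiff 1)^[j] a n‖ ≤ δ := by
  induction j with
  | zero => exact fun a h => h
  | succ j ih =>
    intro a h
    rw [Function.iterate_succ_apply]
    refine ih _ fun n => ?_
    rw [fwdDiff, sub_eq_add_neg]
    exact (IsUltrametricDist.norm_add_le_max _ _).trans
      (max_le (h _) ((norm_neg _).trans_le (h _)))

theorem norm_iterate_sub_iterate_le (hA : ∀ x : K, x ∈ A ↔ ‖x‖ ≤ 1) {f : K → K} {φ : A[X]}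
    {δ : ℝ} (hδ : 0 ≤ δ) (hf : ∀ u, ‖u‖ ≤ 1 → ‖f u‖ ≤ 1)
    (hφ : ∀ u, ‖u‖ ≤ 1 → ‖f u - aeval u φ‖ ≤ δ) {u : K} (hu : ‖u‖ ≤ 1) (n : ℕ) :
    ‖f^[n] u‖ ≤ 1 ∧ ‖(fun y => aeval y φ)^[n] u‖ ≤ 1 ∧
      ‖f^[n] u - (fun y => aeval y φ)^[n] u‖ ≤ δ := by
  induction n with
  | zero => simpa [hu] using hδ
  | succ n ih =>
    obtain ⟨h1, h2, h3⟩ := ih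
    simp only [Function.iterate_succ_apply']
    refine ⟨hf _ h1, norm_aeval_le_one hA _ h2, ?_⟩
    rw [← sub_add_sub_cancel _ (aeval (f^[n] u) φ)]
    exact (IsUltrametricDist.norm_add_le_max _ _).trans
      (max_le (hφ _ h1) ((norm_aeval_sub_le hA φ h1 h2).trans h3))

/-- A self-map of the closed unit disc which is approximated to any precision by integral
polynomials having an iterate congruent to the identity modulo `c`. -/
theorem norm_fwdDiff_iter_iterate_le (hA : ∀ x : K, x ∈ A ↔ ‖x‖ ≤ 1) {f : K → K} {φ : ℕ → A[X]}
    {π c : A} (hπ : ‖(π : K)‖ < 1) (hf : ∀ u, ‖u‖ ≤ 1 → ‖f u‖ ≤ 1)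
    (hφ : ∀ J u, ‖u‖ ≤ 1 → ‖f u - aeval u (φ J)‖ ≤ ‖(π : K)‖ ^ J) {M : ℕ}
    (hM : ∀ J, C c ∣ iterComp (φ J) M - X) (j n : ℕ) :
    ‖(fwdDiff 1)^[j] (fun n => f^[M * n] 0) n‖ ≤ ‖(c : K)‖ ^ j := by
  have h0 : ‖(0 : K)‖ ≤ 1 := by simp
  -- The orbit is the orbit under `φ J`, whose `j`-th differences carry the factor `c ^ j`, plus an
  -- error of norm at most `|π| ^ J`. Differences do not enlarge the error, and `J → ∞` with `j`
  -- fixed removes it.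
  have key : ∀ J, ‖(fwdDiff 1)^[j] (fun n => f^[M * n] 0) n‖ ≤
      max (‖(c : K)‖ ^ j) (‖(π : K)‖ ^ J) := by
    intro J
    have happ := norm_iterate_sub_iterate_le hA (pow_nonneg (norm_nonneg (π : K)) J) hf (hφ J) h0
    set v : ℕ → K := fun n => (fun y => aeval y (φ J))^[M * n] 0 with hv
    have hsplit : (fun n => f^[M * n] 0) = v + fun n => f^[M * n] 0 - v n := by
      ext n; simp
    rw [hsplit, fwdDiff_iter_add]
    refine (IsUltrametricDist.norm_add_le_max _ _).trans (max_le_max ?_ ?_)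
    · obtain ⟨Q, hQ⟩ := exists_fwdDiff_iter_aeval_eq (hM J) (0 : K) j X
      have hit : (fun y : K => aeval y (iterComp (φ J) M)) = (fun y => aeval y (φ J))^[M] := by
        ext y
        exact aeval_iterComp _ _ _
      have hv' : v = fun n : ℕ =>
          aeval ((fun y : K => aeval y (iterComp (φ J) M))^[n] 0) (X : A[X]) := by
        ext n
        rw [aeval_X, hit, ← Function.iterate_mul]
      rw [hv', hQ, hit, ← Function.iterate_mul, norm_mul, norm_pow]
      exact mul_le_of_le_one_right (by positivity) (norm_aeval_le_one hA _ (happ _).2.1)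
    · exact norm_fwdDiff_iter_le j _ (fun n => (happ _).2.2) n
  have hlim := (tendsto_const_nhds (x := ‖(c : K)‖ ^ j)).max
    (tendsto_pow_atTop_nhds_zero_of_lt_one (norm_nonneg _) hπ)
  rw [max_eq_left (by positivity)] at hlim
  exact ge_of_tendsto' hlim key

theorem C_dvd_iterComp_sub_X {R : Type*} [CommRing R] {c : R} {ψ : R[X]} (h : C c ∣ ψ - X)
    (k : ℕ) : C c ∣ iterComp ψ k - X := by
  have h1 : C c ∣ ψ - (C 1 * X + C 0) := by simpa using h
  simpa using C_dvd_iterComp_sub_affine h1 k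

/-- The orbit of `0` under a quotient of integral polynomials which is a bijection of the open
unit disc is interpolated along an arithmetic progression. -/
theorem exists_diffBounded_iterate (hA : ∀ x : K, x ∈ A ↔ ‖x‖ ≤ 1) {p : ℕ}
    (hp0 : (p : K) ≠ 0) (hp1 : ‖(p : K)‖ < 1) (hpp : 0 < p)
    (hfin : ∀ a : A, ‖(a : K)‖ = 1 → ∃ M > 0, ‖(a : K) ^ M - 1‖ < 1) {L U : A[X]}
    (hL : ‖(L.coeff 0 : K)‖ = 1) (hU0 : ‖(U.coeff 0 : K)‖ < 1) (hU1 : ‖(U.coeff 1 : K)‖ = 1)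
    {h : K → K} (hh : ∀ t, h t = aeval t U / aeval t L) :
    ∃ M > 0, ∀ k, DiffBounded (‖(p : K)‖ ^ 2) fun n => h^[M * k * n] 0 := by
  obtain ⟨ν, hν⟩ := ((isUnit_iff_norm_eq_one hA).2 hL).exists_right_inv
  have hνK : (L.coeff 0 : K) * (ν : K) = 1 := by exact_mod_cast hν
  have hν1 : ‖(ν : K)‖ = 1 := by
    have := congrArg norm hνK
    rwa [norm_mul, hL, one_mul, norm_one] at this
  set a : A := ν * U.coeff 1 with ha
  have ha1 : ‖(a : K)‖ = 1 := by rw [ha]; push_cast; rw [norm_mul, hν1, hU1, one_mul]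
  obtain ⟨M₀, hM₀, haM⟩ := hfin a ha1
  -- Divisibility of `U.coeff 0` makes `h (π u) / π` integral; divisibility of `p` and of `a ^ M₀ -
  -- 1` makes an iterate the identity modulo `π`.
  obtain ⟨π, hπ0, hπ1, hπp, hπU, hπa⟩ : ∃ π : A, π ≠ 0 ∧ ‖(π : K)‖ < 1 ∧ π ∣ (p : A) ∧
      π ∣ U.coeff 0 ∧ π ∣ a ^ M₀ - 1 := by
    have hpA : (p : A) ≠ 0 := fun h => hp0 (by simpa using congrArg (Subtype.val) h)
    obtain ⟨z, hz0, hz1, hzp, hzU⟩ := exists_common_dvd hA hpA (by simpa using hp1) hU0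
    obtain ⟨w, hw0, hw1, hwz, hwa⟩ := exists_common_dvd hA (y := a ^ M₀ - 1) hz0 hz1
      (by push_cast; exact haM)
    exact ⟨w, hw0, hw1, hwz.trans hzp, hwz.trans hzU, hwa⟩
  have hπK : (π : K) ≠ 0 := fun h => hπ0 (by ext; simpa using h)
  obtain ⟨b₀, hb₀⟩ := hπU
  -- After `t = π u` one has `U(t) = π V(u)` and `ν L(t) = 1 - π g(u)`, so `f = h(π ·) / π` equals
  -- `ν V / (1 - π g)`, and `φ J` truncates its geometric series.
  let S : A[X] := C π * X
  let V : A[X] := C b₀ + X * U.divX.comp S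
  let g : A[X] := -(C ν * X * L.divX.comp S)
  let φ : ℕ → A[X] := fun J => C ν * V * ∑ i ∈ range J, (C π * g) ^ i
  let f : K → K := fun u => ν * aeval u V / (1 - π * aeval u g)
  have hS : ∀ u : K, aeval u S = π * u := fun u => by simp [S]
  have hV : ∀ u : K, aeval (π * u) U = π * aeval u V := by
    intro u
    conv_lhs => rw [← divX_mul_X_add U]
    simp only [V, map_add, map_mul, aeval_X, aeval_C, aeval_comp, hS, hb₀]
    simp only [← ValuationSubring.algebraMap_apply]
    ring
  have hg : ∀ u : K, (ν : K) * aeval (π * u) L = 1 - π * aeval u g := by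
    intro u
    conv_lhs => rw [← divX_mul_X_add L]
    simp only [g, map_add, map_mul, map_neg, aeval_X, aeval_C, aeval_comp, hS]
    simp only [← ValuationSubring.algebraMap_apply] at hνK ⊢
    linear_combination hνK
  have hg1 : ∀ u : K, ‖u‖ ≤ 1 → ‖(π : K) * aeval u g‖ ≤ ‖(π : K)‖ := fun u hu => by
    rw [norm_mul]
    exact mul_le_of_le_one_right (norm_nonneg _) (norm_aeval_le_one hA _ hu)
  have hden : ∀ u : K, ‖u‖ ≤ 1 → ‖1 - (π : K) * aeval u g‖ = 1 := by
    intro u hu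
    have h1 : ‖-((π : K) * aeval u g)‖ < ‖(1 : K)‖ := by
      rw [norm_neg, norm_one]
      exact (hg1 u hu).trans_lt hπ1
    rw [sub_eq_add_neg, IsUltrametricDist.norm_add_eq_max_of_norm_ne_norm h1.ne',
      max_eq_left h1.le, norm_one]
  have hhf : ∀ u : K, h (π * u) = π * f u := by
    intro u
    have hν0 : (ν : K) ≠ 0 := right_ne_zero_of_mul_eq_one hνK
    rw [hh, hV, ← mul_div_mul_left _ _ hν0, hg]
    simp only [f]
    ring
  have hf : ∀ u : K, ‖u‖ ≤ 1 → ‖f u‖ ≤ 1 := by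
    intro u hu
    simp only [f]
    rw [norm_div, hden u hu, div_one, norm_mul, hν1, one_mul]
    exact norm_aeval_le_one hA _ hu
  have hφ : ∀ J (u : K), ‖u‖ ≤ 1 → ‖f u - aeval u (φ J)‖ ≤ ‖(π : K)‖ ^ J := by
    intro J u hu
    have hd0 : 1 - (π : K) * aeval u g ≠ 0 := norm_ne_zero_iff.1 (by rw [hden u hu]; simp)
    have h1 : f u - aeval u (φ J) = f u * ((π : K) * aeval u g) ^ J := by
      have h2 : aeval u (φ J) = ν * aeval u V * ∑ i ∈ range J, ((π : K) * aeval u g) ^ i := by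
        simp only [φ, map_mul, map_sum, map_pow, aeval_C]
        rfl
      have h3 := mul_neg_geom_sum ((π : K) * aeval u g) J
      rw [h2]
      simp only [f]
      field_simp
      linear_combination -(ν : K) * aeval u V * h3
    rw [h1, norm_mul, norm_pow]
    exact (mul_le_of_le_one_left (by positivity) (hf u hu)).trans
      (pow_le_pow_left₀ (norm_nonneg _) (hg1 u hu) J)
  -- The index is `J + 1` because the empty truncation `φ 0` is zero.
  have haff : ∀ J, C π ∣ φ (J + 1) - (C a * X + C (ν * b₀)) := by
    intro J
    have h1 : C π ∣ U.divX.comp S - C (U.coeff 1) := by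
      have h2 : C π ∣ S - 0 := by simp [S]
      have h3 := C_dvd_comp_sub_comp h2 U.divX
      rwa [comp_zero, ← coeff_zero_eq_eval_zero, coeff_divX] at h3
    have h2 := dvd_mul_of_dvd_right h1 (C ν * X)
    have h3 := dvd_mul_right (C π) (C ν * V * g * ∑ i ∈ range J, (C π * g) ^ i)
    convert dvd_add h2 h3 using 1
    simp only [φ, geom_sum_succ, V, ha, map_mul]
    ring
  -- With `|π| ^ s < |p| ^ 2`, identity modulo `π ^ (s + 1)` gives the required rate.
  obtain ⟨s, hs⟩ := exists_pow_lt_of_lt_one (pow_pos (norm_pos_iff.2 hp0) 2) hπ1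
  refine ⟨M₀ * p * p ^ s, by positivity, fun k => ?_⟩
  have hM : ∀ J, C (π ^ (s + 1)) ∣ iterComp (φ (J + 1)) (M₀ * p * p ^ s * k) - X := fun J => by
    rw [iterComp_mul]
    exact C_dvd_iterComp_sub_X (C_pow_dvd_iterComp_sub_X (haff J) hπa hπp s) k
  have hφ' : ∀ J (u : K), ‖u‖ ≤ 1 → ‖f u - aeval u (φ (J + 1))‖ ≤ ‖(π : K)‖ ^ J :=
    fun J u hu => (hφ (J + 1) u hu).trans (pow_le_pow_of_le_one (norm_nonneg _) hπ1.le (by omega))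
  have hbd := norm_fwdDiff_iter_iterate_le hA hπ1 hf hφ' hM
  have hconj : ∀ n, h^[n] 0 = π * f^[n] 0 := by
    intro n
    induction n with
    | zero => simp
    | succ n ih => rw [Function.iterate_succ_apply', ih, hhf, Function.iterate_succ_apply']
  have hbd' : DiffBounded (‖(p : K)‖ ^ 2) fun n => f^[M₀ * p * p ^ s * k * n] 0 := by
    refine ⟨1, zero_le_one, fun j n => (hbd j n).trans ?_⟩
    rw [one_mul]
    refine pow_le_pow_left₀ (norm_nonneg _) ?_ j
    push_cast
    rw [norm_pow]
    exact (pow_le_pow_of_le_one (norm_nonneg _) hπ1.le (Nat.le_succ s)).trans hs.le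
  simp only [hconj]
  exact (DiffBounded.const (by positivity) (π : K)).mul (by positivity) hbd'

end Interpolation

end DynP1

namespace DynP1

/-! ### Pairs of binary forms acting on the plane -/

section Forms

variable {A : Type*} [CommRing A]

/-- The self-map of `R²` given by a pair of polynomials over `A`, for an `A`-algebra `R`. -/
noncomputable def formMap (H : Fin 2 → MvPolynomial (Fin 2) A) {R : Type*} [CommRing R]
    [Algebra A R] (v : Fin 2 → R) : Fin 2 → R :=
  fun i => MvPolynomial.aeval v (H i)

variable (H : Fin 2 → MvPolynomial (Fin 2) A) {R S : Type*} [CommRing R] [Algebra A R]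
  [CommRing S] [Algebra A S]

theorem formMap_comp_algHom (φ : R →ₐ[A] S) (v : Fin 2 → R) :
    formMap H (φ ∘ v) = φ ∘ formMap H v := by
  ext i
  exact (MvPolynomial.comp_aeval_apply v φ (H i)).symm

theorem formMap_iterate_comp_algHom (φ : R →ₐ[A] S) (n : ℕ) (v : Fin 2 → R) :
    (formMap H)^[n] (φ ∘ v) = φ ∘ (formMap H)^[n] v := by
  induction n with
  | zero => rfl
  | succ n ih => rw [Function.iterate_succ_apply', ih, formMap_comp_algHom,
      Function.iterate_succ_apply']

theorem aeval_smul_of_isHomogeneous {F : MvPolynomial (Fin 2) A} {d : ℕ} (hF : F.IsHomogeneous d)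
    (t : R) (v : Fin 2 → R) : MvPolynomial.aeval (t • v) F = t ^ d * MvPolynomial.aeval v F := by
  simp only [MvPolynomial.aeval_def, MvPolynomial.eval₂_eq', Finset.mul_sum]
  refine Finset.sum_congr rfl fun m hm => ?_
  have hd : m 0 + m 1 = d := by
    have := hF (MvPolynomial.mem_support_iff.1 hm)
    simpa [Finsupp.weight_apply, Finsupp.sum_fintype, Fin.sum_univ_two] using this
  simp only [Fin.prod_univ_two, Pi.smul_apply, smul_eq_mul, mul_pow, ← hd, pow_add]
  ring

theorem formMap_smul {d : ℕ} (hH : ∀ i, (H i).IsHomogeneous d) (t : R) (v : Fin 2 → R) :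
    formMap H (t • v) = t ^ d • formMap H v := by
  ext i
  exact aeval_smul_of_isHomogeneous (hH i) t v

/-- The determinant of a pair of vectors in the plane. -/
def det2 (v w : Fin 2 → R) : R := v 0 * w 1 - v 1 * w 0

theorem det2_smul_smul (s t : R) (v w : Fin 2 → R) :
    det2 (s • v) (t • w) = s * t * det2 v w := by
  simp only [det2, Pi.smul_apply, smul_eq_mul]
  ring

theorem det2_comp (φ : R →+* S) (v w : Fin 2 → R) : det2 (φ ∘ v) (φ ∘ w) = φ (det2 v w) := by
  simp [det2]

theorem det2_smul_eq (u e v : Fin 2 → R) :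
    det2 u e • v = det2 v e • u + det2 u v • e := by
  ext i
  fin_cases i <;> simp [det2] <;> ring

theorem exists_eq_smul_of_det2_eq_zero {v w : Fin 2 → R} {i : Fin 2} (hv : IsUnit (v i))
    (h : det2 v w = 0) : ∃ t : R, w = t • v := by
  obtain ⟨u, hu⟩ := hv.exists_left_inv
  refine ⟨u * w i, ?_⟩
  simp only [det2] at h
  ext j
  simp only [Pi.smul_apply, smul_eq_mul]
  fin_cases i <;> fin_cases j <;> simp only [Fin.zero_eta, Fin.mk_one] at *
  · linear_combination -w 0 * hu
  · linear_combination -w 1 * hu + u * h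
  · linear_combination -w 0 * hu - u * h
  · linear_combination -w 1 * hu

theorem det2_formMap_formMap_smul {d : ℕ} (hH : ∀ i, (H i).IsHomogeneous d) (t : R)
    (v : Fin 2 → R) : det2 (formMap H v) (formMap H (t • v)) = 0 := by
  rw [formMap_smul H hH]
  simp only [det2, Pi.smul_apply, smul_eq_mul]
  ring

/-- Modulo `det2 v w` the vectors are proportional, because `v` has a unit coordinate; by
homogeneity so are their images. This is the source of non-expansion for the chordal distance. -/
theorem det2_dvd_det2_formMap {d : ℕ} (hH : ∀ i, (H i).IsHomogeneous d) {v w : Fin 2 → A}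
    {i : Fin 2} (hv : IsUnit (v i)) :
    det2 v w ∣ det2 (formMap H v) (formMap H w) := by
  rw [← Ideal.mem_span_singleton, ← Ideal.Quotient.eq_zero_iff_mem]
  let φ : A →ₐ[A] A ⧸ Ideal.span {det2 v w} := Ideal.Quotient.mkₐ A _
  let ρ : A →+* A ⧸ Ideal.span {det2 v w} := Ideal.Quotient.mk _
  have h1 : det2 (φ ∘ v) (φ ∘ w) = 0 := by
    rw [show (φ ∘ v) = ρ ∘ v from rfl, show (φ ∘ w) = ρ ∘ w from rfl,
      det2_comp]
    exact Ideal.Quotient.eq_zero_iff_mem.2 (Ideal.mem_span_singleton_self _)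
  obtain ⟨t, ht⟩ := exists_eq_smul_of_det2_eq_zero (i := i) (hv.map φ) h1
  have h2 : ρ (det2 (formMap H v) (formMap H w)) = 0 := by
    rw [← det2_comp]
    have h3 : ∀ x : Fin 2 → A, ρ ∘ formMap H x = formMap H (φ ∘ x) :=
      fun x => (formMap_comp_algHom H φ x).symm
    rw [h3, h3, ht]
    exact det2_formMap_formMap_smul H hH t _
  exact h2

/-- Modulo the linear form, `(X 0, X 1)` becomes a multiple `t v`, so `F` becomes `t ^ d F(v) = 0`.
-/
theorem linearForm_dvd_of_eval_eq_zero {k : Type*} [Field k] {F : MvPolynomial (Fin 2) k} {d : ℕ}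
    (hF : F.IsHomogeneous d) {v : Fin 2 → k} (hv : v ≠ 0) (h : MvPolynomial.eval v F = 0) :
    MvPolynomial.C (v 1) * MvPolynomial.X 0 - MvPolynomial.C (v 0) * MvPolynomial.X 1 ∣ F := by
  set l : MvPolynomial (Fin 2) k :=
    MvPolynomial.C (v 1) * MvPolynomial.X 0 - MvPolynomial.C (v 0) * MvPolynomial.X 1 with hl
  rw [← Ideal.mem_span_singleton, ← Ideal.Quotient.eq_zero_iff_mem]
  let φ : MvPolynomial (Fin 2) k →ₐ[k] MvPolynomial (Fin 2) k ⧸ Ideal.span {l} :=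
    Ideal.Quotient.mkₐ k _
  let ψ : k →ₐ[k] MvPolynomial (Fin 2) k ⧸ Ideal.span {l} := Algebra.ofId _ _
  have hψ : ∀ c, φ (MvPolynomial.C c) = ψ c := fun c => φ.commutes c
  have hl0 : ψ (v 1) * φ (MvPolynomial.X 0) - ψ (v 0) * φ (MvPolynomial.X 1) = 0 := by
    rw [← hψ, ← hψ, ← map_mul, ← map_mul, ← map_sub]
    exact Ideal.Quotient.eq_zero_iff_mem.2 (Ideal.mem_span_singleton_self _)
  obtain ⟨i, hi⟩ := Function.ne_iff.1 hv
  obtain ⟨t, ht⟩ := exists_eq_smul_of_det2_eq_zero (v := ψ ∘ v) (w := φ ∘ MvPolynomial.X) (i := i)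
    ((IsUnit.mk0 _ hi).map ψ) (by simp only [det2, Function.comp_apply]; linear_combination -hl0)
  have h1 : φ F = MvPolynomial.aeval (φ ∘ MvPolynomial.X) F := by
    conv_lhs => rw [← MvPolynomial.aeval_X_left_apply F, ← AlgHom.comp_apply,
      MvPolynomial.comp_aeval]
    rfl
  have h2 : MvPolynomial.aeval (ψ ∘ v) F = ψ (MvPolynomial.eval v F) := by
    have := MvPolynomial.comp_aeval_apply v ψ F
    rw [MvPolynomial.aeval_eq_eval] at this
    exact this.symm
  change φ F = 0
  rw [h1, ht, aeval_smul_of_isHomogeneous hF, h2, h, map_zero, mul_zero]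

/-- A common zero `v` would give a common linear factor, which is not a unit since it vanishes at
`v`. -/
theorem formMap_ne_zero {k : Type*} [Field k] [Algebra A k] {d : ℕ}
    (hH : ∀ i, (H i).IsHomogeneous d)
    (hrel : IsRelPrime (MvPolynomial.map (algebraMap A k) (H 0))
      (MvPolynomial.map (algebraMap A k) (H 1))) {v : Fin 2 → k} (hv : v ≠ 0) :
    formMap H v ≠ 0 := by
  intro h0
  have key : ∀ i, MvPolynomial.C (v 1) * MvPolynomial.X 0 - MvPolynomial.C (v 0) * MvPolynomial.X 1
      ∣ MvPolynomial.map (algebraMap A k) (H i) := by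
    intro i
    refine linearForm_dvd_of_eval_eq_zero ((hH i).map _) hv ?_
    rw [MvPolynomial.eval_map]
    exact congrFun h0 i
  have h1 := (hrel (key 0) (key 1)).map (MvPolynomial.eval v)
  refine h1.ne_zero ?_
  simp only [map_sub, map_mul, MvPolynomial.eval_C, MvPolynomial.eval_X]
  ring

/-- The coordinates of `v` and the coefficients of the forms generate a ring that is finite over `ℤ`
and killed by `p`, hence finite; the orbit stays in it and the pigeonhole principle applies. -/
theorem exists_iterate_formMap_eq {k : Type*} [Field k] [Algebra A k]
    (hk : ∀ x : k, (Int.castRingHom k).IsIntegralElem x) {p : ℕ} (hp : p ≠ 0) (hpk : (p : k) = 0) (v : Fin 2 → k) :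
    ∃ m N, 0 < N ∧ (formMap H)^[m + N] v = (formMap H)^[m] v := by
  classical
  let s : Set k := Set.range v ∪ ⋃ i, (fun m => algebraMap A k ((H i).coeff m)) '' (H i).support
  have hs : s.Finite := (Set.finite_range v).union
    (Set.finite_iUnion fun i => (Finset.finite_toSet _).image _)
  let B := Algebra.adjoin ℤ s
  have : Module.Finite ℤ B := Algebra.finite_adjoin_of_finite_of_isIntegral hs
    fun x _ => hk x
  have : Finite B := by
    refine Module.finite_of_fg_torsion B fun {x} => ⟨⟨(p : ℤ), ?_⟩, ?_⟩
    · exact mem_nonZeroDivisors_of_ne_zero (by exact_mod_cast hp)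
    · ext
      simp [Submonoid.smul_def, hpk]
  have hB : ∀ n i, (formMap H)^[n] v i ∈ B := by
    intro n
    induction n with
    | zero => exact fun i => Algebra.subset_adjoin (Or.inl ⟨i, rfl⟩)
    | succ n ih =>
      intro i
      rw [Function.iterate_succ_apply', formMap, MvPolynomial.aeval_def, MvPolynomial.eval₂_eq']
      refine sum_mem fun m hm => mul_mem ?_ (prod_mem fun j _ => pow_mem (ih j) _)
      exact Algebra.subset_adjoin (Or.inr (Set.mem_iUnion.2 ⟨i, m, hm, rfl⟩))
  obtain ⟨m, n, hmn, h⟩ := Finite.exists_ne_map_eq_of_infinite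
    fun n : ℕ => fun i => (⟨(formMap H)^[n] v i, hB n i⟩ : B)
  have h' : (formMap H)^[m] v = (formMap H)^[n] v := by
    ext i
    exact congrArg Subtype.val (congrFun h i)
  rcases lt_or_gt_of_ne hmn with h1 | h1
  · exact ⟨m, n - m, by omega, by rw [Nat.add_sub_cancel' h1.le, h']⟩
  · exact ⟨n, m - n, by omega, by rw [Nat.add_sub_cancel' h1.le, h']⟩

/-- The preceding lemma for scaling by `x`, whose orbit of `(1, 1)` lists the powers of `x`. -/
theorem exists_pow_eq_one {k : Type*} [Field k]
    (hk : ∀ x : k, (Int.castRingHom k).IsIntegralElem x) {p : ℕ} (hp : p ≠ 0) (hpk : (p : k) = 0) {x : k} (hx : x ≠ 0) : ∃ M > 0, x ^ M = 1 := by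
  let v : Fin 2 → k := ![1, 1]
  let H : Fin 2 → MvPolynomial (Fin 2) k := fun i => MvPolynomial.C x * MvPolynomial.X i
  have hH : ∀ n, (formMap H)^[n] v = fun _ => x ^ n := by
    intro n
    induction n with
    | zero => ext i; fin_cases i <;> simp [v]
    | succ n ih =>
      rw [Function.iterate_succ_apply', ih]
      ext i
      simp [formMap, H, pow_succ']
  obtain ⟨m, N, hN, h⟩ := exists_iterate_formMap_eq H hk hp hpk v
  refine ⟨N, hN, ?_⟩
  rw [hH, hH] at h
  have := congrFun h 0
  simp only [pow_add] at this
  exact mul_left_cancel₀ (pow_ne_zero m hx) (by rw [this, mul_one])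

end Forms

end DynP1

namespace DynP1

open Filter Topology

/-! ### Homogeneous coordinates -/

section Representatives

variable {K : Type*} [Field K]

/-- The vector `v` consists of homogeneous coordinates of the point `P`. -/
def IsRep (P : P1 K) (v : Fin 2 → K) : Prop :=
  ∃ hv : v ≠ 0, P = Projectivization.mk K v hv

theorem isRep_rep (P : P1 K) : IsRep P P.rep := ⟨P.rep_nonzero, P.mk_rep.symm⟩

theorem IsRep.ne_zero {P : P1 K} {v : Fin 2 → K} (h : IsRep P v) : v ≠ 0 := h.1

theorem IsRep.exists_rep_eq {P : P1 K} {v : Fin 2 → K} (h : IsRep P v) :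
    ∃ c : K, c ≠ 0 ∧ P.rep = c • v := by
  obtain ⟨hv, rfl⟩ := h
  obtain ⟨a, ha⟩ := Projectivization.exists_smul_eq_mk_rep K v hv
  exact ⟨a, a.ne_zero, ha.symm⟩

theorem IsRep.smul {P : P1 K} {v : Fin 2 → K} (h : IsRep P v) {c : K} (hc : c ≠ 0) :
    IsRep P (c • v) := by
  obtain ⟨hv, rfl⟩ := h
  exact ⟨smul_ne_zero hc hv, (Projectivization.mk_eq_mk_iff' K _ _ _ _).2
    ⟨c⁻¹, by rw [smul_smul, inv_mul_cancel₀ hc, one_smul]⟩⟩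

theorem IsRep.eq {P Q : P1 K} {v : Fin 2 → K} (h : IsRep P v) (h' : IsRep Q v) : P = Q := by
  obtain ⟨hv, rfl⟩ := h
  obtain ⟨hv', rfl⟩ := h'
  rfl

theorem homLift_smul (f : RatFunc K) (t : K) (v : Fin 2 → K) :
    homLift f (t • v) = t ^ ratDegree f • homLift f v := by
  have h1 := aeval_smul_of_isHomogeneous
    (Polynomial.isHomogeneous_homogenize (n := ratDegree f) f.num) t v
  have h2 := aeval_smul_of_isHomogeneous
    (Polynomial.isHomogeneous_homogenize (n := ratDegree f) f.denom) t v
  rw [MvPolynomial.aeval_eq_eval] at h1 h2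
  ext i
  fin_cases i
  · exact h1
  · exact h2

theorem IsRep.act {P : P1 K} {v : Fin 2 → K} (h : IsRep P v) (f : RatFunc K) :
    IsRep (act f P) (homLift f v) := by
  obtain ⟨c, hc, hP⟩ := h.exists_rep_eq
  have h1 : IsRep (DynP1.act f P) (homLift f P.rep) := ⟨homLift_ne_zero f _ P.rep_nonzero, rfl⟩
  rw [hP, homLift_smul] at h1
  have h2 := h1.smul (inv_ne_zero (pow_ne_zero (ratDegree f) hc))
  rwa [smul_smul, inv_mul_cancel₀ (pow_ne_zero _ hc), one_smul] at h2

end Representatives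

/-! ### The chordal distance and affine coordinates -/

section Chordal

variable {K : Type*} [NormedField K]

/-- The chordal distance on the projective line. -/
noncomputable def chordal (P Q : P1 K) : ℝ := ‖det2 P.rep Q.rep‖ / (‖P.rep‖ * ‖Q.rep‖)

theorem chordal_eq {P Q : P1 K} {v w : Fin 2 → K} (hv : IsRep P v) (hw : IsRep Q w) :
    chordal P Q = ‖det2 v w‖ / (‖v‖ * ‖w‖) := by
  obtain ⟨c, hc, hP⟩ := hv.exists_rep_eq
  obtain ⟨d, hd, hQ⟩ := hw.exists_rep_eq
  have h1 := norm_pos_iff.2 hc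
  have h2 := norm_pos_iff.2 hd
  have h3 := norm_pos_iff.2 hv.ne_zero
  have h4 := norm_pos_iff.2 hw.ne_zero
  rw [chordal, hP, hQ, det2_smul_smul, norm_smul, norm_smul, norm_mul, norm_mul]
  field_simp

theorem norm_fin_two (v : Fin 2 → K) : ‖v‖ = max ‖v 0‖ ‖v 1‖ := by
  refine le_antisymm ((pi_norm_le_iff_of_nonneg (le_max_of_le_left (norm_nonneg _))).2 ?_)
    (max_le (norm_le_pi_norm v 0) (norm_le_pi_norm v 1))
  intro i
  fin_cases i
  · exact le_max_left _ _
  · exact le_max_right _ _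

variable [IsUltrametricDist K]

/-- Near a point with `j`-th coordinate nonzero, the chordal distance is proportional to the
distance of the affine coordinates. -/
theorem chordal_eq_of_lt {i j : Fin 2} (hij : i ≠ j) {P z : P1 K} (hz : z.rep j ≠ 0)
    (h : chordal P z < 1 / max ‖z.rep i / z.rep j‖ 1) :
    P.rep j ≠ 0 ∧ chordal P z
      = ‖P.rep i / P.rep j - z.rep i / z.rep j‖ / max ‖z.rep i / z.rep j‖ 1 ^ 2 := by
  set s := z.rep i / z.rep j with hs
  set m := max ‖s‖ 1 with hm
  set v := P.rep with hv
  have hm1 : 1 ≤ m := le_max_right _ _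
  have hm0 : 0 < m := one_pos.trans_le hm1
  have hnorm : ∀ u : Fin 2 → K, ‖u‖ = max ‖u i‖ ‖u j‖ := by
    intro u
    rw [norm_fin_two]
    fin_cases i <;> fin_cases j <;> first | exact absurd rfl hij | rfl | exact max_comm _ _
  have hdet : ∀ u u' : Fin 2 → K, ‖det2 u u'‖ = ‖u i * u' j - u j * u' i‖ := by
    intro u u'
    fin_cases i <;> fin_cases j <;> first
      | exact absurd rfl hij
      | rfl
      | (rw [← norm_neg]; simp only [det2]; congr 1; simp)
  have hz' := (isRep_rep z).smul (inv_ne_zero hz)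
  set w := (z.rep j)⁻¹ • z.rep with hw
  have hwi : w i = s := by simp [hw, hs, div_eq_inv_mul]
  have hwj : w j = 1 := by simp [hw, hz]
  have hwn : ‖w‖ = m := by rw [hnorm, hwi, hwj, norm_one]
  have hM : 0 < ‖v‖ := norm_pos_iff.2 P.rep_nonzero
  have hch : chordal P z = ‖v i - v j * s‖ / (‖v‖ * m) := by
    rw [chordal_eq (isRep_rep P) hz', hdet, hwi, hwj, hwn, mul_one]
  have hlt : ‖v i - v j * s‖ < ‖v‖ := by
    rw [hch, div_lt_div_iff₀ (by positivity) hm0] at h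
    nlinarith
  have hvi : ‖v i‖ ≤ ‖v‖ := norm_le_pi_norm v i
  have hvj : ‖v j‖ ≤ ‖v‖ := norm_le_pi_norm v j
  have hle : ‖v j‖ * m ≤ ‖v‖ := by
    have h1 : ‖v j * s‖ ≤ ‖v‖ := by
      have h2 : v j * s = v i + -(v i - v j * s) := by ring
      rw [h2]
      refine (IsUltrametricDist.norm_add_le_max _ _).trans (max_le hvi ?_)
      rw [norm_neg]
      exact hlt.le
    rw [hm, mul_max_of_nonneg _ _ (norm_nonneg _), mul_one, ← norm_mul]
    exact max_le h1 hvj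
  -- Otherwise both coordinates of `v` would have norm below `‖v‖`.
  have hge : ‖v‖ ≤ ‖v j‖ * m := by
    by_contra! hlt'
    have h1 : ‖v j‖ * ‖s‖ < ‖v‖ :=
      (mul_le_mul_of_nonneg_left (le_max_left _ _) (norm_nonneg _)).trans_lt hlt'
    have h2 : ‖v j‖ < ‖v‖ :=
      (le_mul_of_one_le_right (norm_nonneg _) hm1).trans_lt hlt'
    have h3 : ‖v i‖ < ‖v‖ := by
      have h4 : v i = (v i - v j * s) + v j * s := by ring
      rw [h4]
      exact (IsUltrametricDist.norm_add_le_max _ _).trans_lt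
        (max_lt hlt (by rwa [norm_mul]))
    have h5 := hnorm v
    exact (max_lt h3 h2).ne h5.symm
  have heq : ‖v‖ = ‖v j‖ * m := le_antisymm hge hle
  have hvj0 : v j ≠ 0 := by
    intro h0
    rw [heq, h0] at hM
    simp at hM
  refine ⟨hvj0, ?_⟩
  have h6 : v i / v j - s = (v i - v j * s) / v j := by field_simp
  have h7 := norm_pos_iff.2 hvj0
  rw [hch, heq, h6, norm_div]
  field_simp

/-- If `φ` shrank the distance to `s`, the linear term would dominate in the ultrametric sense, so
the error would have norm at least `|x - s|`, against its bound `|x - s| / 2`. -/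
theorem eventually_norm_sub_le_of_hasDerivAt {K : Type*} [NontriviallyNormedField K]
    [IsUltrametricDist K] {φ : K → K} {l s : K}
    (h : HasDerivAt φ l s) (hl : 1 ≤ ‖l‖) : ∀ᶠ x in 𝓝 s, ‖x - s‖ ≤ ‖φ x - φ s‖ := by
  have h1 := h.isLittleO.def (c := 1 / 2) (by norm_num)
  filter_upwards [h1] with x hx
  by_contra! hlt
  have h2 : ‖x - s‖ ≤ ‖(x - s) • l‖ := by
    rw [norm_smul]
    exact le_mul_of_one_le_right (norm_nonneg _) hl
  have h3 : ‖φ x - φ s - (x - s) • l‖ = ‖(x - s) • l‖ := by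
    rw [sub_eq_add_neg, IsUltrametricDist.norm_add_eq_max_of_norm_ne_norm
      (by rw [norm_neg]; exact (hlt.trans_le h2).ne), norm_neg, max_eq_right (hlt.trans_le h2).le]
  have h4 : ‖(x - s) • l‖ ≤ 1 / 2 * ‖x - s‖ := h3 ▸ hx
  have h5 := (norm_nonneg _).trans_lt hlt
  linarith

end Chordal

/-! ### Detecting attracting points without computing a derivative -/

section Multiplier

variable {K : Type*} [NontriviallyNormedField K] [IsUltrametricDist K]

/-- Near `z` the chordal distance to `z` is a constant multiple of the affine one, and non-expansion
keeps `F P` in the same neighbourhood, so the constant cancels. The indices `i`, `j` treat both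
coordinates of the line at once. -/
theorem exists_chordal_le_chordal {F : P1 K → P1 K}
    (hF : ∀ P Q, chordal (F P) (F Q) ≤ chordal P Q) {z : P1 K} (hz : F z = z)
    {i j : Fin 2} (hij : i ≠ j) (hzj : z.rep j ≠ 0) {κ : K → P1 K}
    (hκ : ∀ s, ∃ v : Fin 2 → K, v i = s ∧ v j = 1 ∧ IsRep (κ s) v)
    (hm : 1 ≤ ‖deriv (fun s => (F (κ s)).rep i / (F (κ s)).rep j) (z.rep i / z.rep j)‖) :
    ∃ η > 0, ∀ P, chordal P z < η → chordal P z ≤ chordal (F P) z := by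
  set s₀ := z.rep i / z.rep j with hs₀
  set m := max ‖s₀‖ 1 with hmdef
  have hm0 : 0 < m := one_pos.trans_le (le_max_right _ _)
  have hκ' : ∀ P : P1 K, P.rep j ≠ 0 → κ (P.rep i / P.rep j) = P := by
    intro P hP
    obtain ⟨v, hvi, hvj, hv⟩ := hκ (P.rep i / P.rep j)
    refine hv.eq ?_
    have h1 := (isRep_rep P).smul (inv_ne_zero hP)
    convert h1
    ext l
    fin_cases i <;> fin_cases j <;> fin_cases l <;> first
      | exact absurd rfl hij
      | (simp only [Fin.zero_eta, Fin.mk_one, Fin.isValue] at hvi hvj hP ⊢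
         simp [hvi, hvj, hP, div_eq_inv_mul])
  -- Differentiability is free: the default derivative `0` would contradict `hm`.
  have hdiff : DifferentiableAt K (fun s => (F (κ s)).rep i / (F (κ s)).rep j) s₀ := by
    by_contra hnd
    rw [deriv_zero_of_not_differentiableAt hnd, norm_zero] at hm
    exact not_le.2 one_pos hm
  have hev := eventually_norm_sub_le_of_hasDerivAt hdiff.hasDerivAt hm
  obtain ⟨ε, hε, hball⟩ := Metric.eventually_nhds_iff.1 hev
  refine ⟨min (1 / m) (ε / m ^ 2), by positivity, fun P hP => ?_⟩
  have hP1 := hP.trans_le (min_le_left _ _)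
  have hP2 := hP.trans_le (min_le_right _ _)
  obtain ⟨hPj, hPe⟩ := chordal_eq_of_lt hij hzj hP1
  have hFz : chordal (F P) z ≤ chordal P z := by
    conv_lhs => rw [← hz]
    exact hF P z
  obtain ⟨-, hFPe⟩ := chordal_eq_of_lt hij hzj (hFz.trans_lt hP1)
  rw [hPe, hFPe]
  rw [hPe] at hP2
  rw [div_lt_div_iff_of_pos_right (by positivity)] at hP2
  have h1 := hball (y := P.rep i / P.rep j) (by rw [dist_eq_norm]; exact hP2)
  simp only [hκ' P hPj] at h1
  rw [hκ' z hzj, hz] at h1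
  gcongr

/-- A periodic point of a non-expanding map, close to which some iterate brings points strictly
closer, is attracting. -/
theorem norm_multiplier_lt_one {f : RatFunc K}
    (hf : ∀ P Q, chordal (act f P) (act f Q) ≤ chordal P Q) {z : P1 K} {N : ℕ}
    (hz : (act f)^[N] z = z)
    (hN : ∀ η > 0, ∃ P, chordal P z < η ∧ chordal ((act f)^[N] P) z < chordal P z) :
    ‖multiplier f z‖ < 1 := by
  set n := Function.minimalPeriod (act f) z with hn
  have hfn : ∀ k, ∀ P Q, chordal ((act f)^[k] P) ((act f)^[k] Q) ≤ chordal P Q := by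
    intro k
    induction k with
    | zero => exact fun P Q => le_rfl
    | succ k ih =>
      intro P Q
      rw [Function.iterate_succ_apply', Function.iterate_succ_apply']
      exact (hf _ _).trans (ih P Q)
  have hzn : (act f)^[n] z = z := Function.iterate_minimalPeriod
  by_contra! hm
  have key : ∃ η > 0, ∀ P, chordal P z < η → chordal P z ≤ chordal ((act f)^[n] P) z := by
    by_cases h1 : z.rep 1 = 0
    · have h0 : z.rep 0 ≠ 0 := by
        intro h0
        refine z.rep_nonzero ?_
        ext i
        fin_cases i
        · exact h0
        · exact h1
      refine exists_chordal_le_chordal (hfn n) hzn (i := 1) (j := 0) (by decide) h0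
        (κ := affinePointInfty) (fun s => ⟨_, rfl, rfl, _, rfl⟩) ?_
      simp only [multiplier, h1, if_true] at hm
      exact hm
    · refine exists_chordal_le_chordal (hfn n) hzn (i := 0) (j := 1) (by decide) h1
        (κ := affinePoint) (fun s => ⟨_, rfl, rfl, _, rfl⟩) ?_
      simp only [multiplier, h1, if_false] at hm
      exact hm
  obtain ⟨η, hη, hkey⟩ := key
  -- The multiplier refers to the exact period `n`, so the lower bound for `n` steps is chained
  -- along the multiple `N`.
  obtain ⟨k, hk⟩ : n ∣ N := Function.IsPeriodicPt.minimalPeriod_dvd hz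
  obtain ⟨P, hP, hlt⟩ := hN η hη
  have hiter : ∀ k, chordal P z ≤ chordal ((act f)^[n * k] P) z := by
    intro k
    induction k with
    | zero => exact le_rfl
    | succ k ih =>
      rw [Nat.mul_succ, Nat.add_comm, Function.iterate_add_apply]
      refine ih.trans (hkey _ ?_)
      have h2 := hfn (n * k) P z
      have h3 : (act f)^[n * k] z = z := (Function.IsPeriodicPt.mul_const hzn k)
      rw [h3] at h2
      exact h2.trans_lt hP
  rw [hk] at hlt
  exact absurd hlt (not_lt.2 (hiter k))

end Multiplier

end DynP1

namespace DynP1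

open Polynomial

/-! ### Integral lifts and charts of residue classes -/

section GoodLift

variable {K : Type*} [NormedField K] {A : ValuationSubring K}

/-- The pair of forms `H` of degree `d` over the valuation ring `A` lifts the action of `f` to the
plane, and is nondegenerate modulo the maximal ideal. -/
structure IsGoodLift (f : RatFunc K) (H : Fin 2 → MvPolynomial (Fin 2) A) (d : ℕ) : Prop where
  isHomogeneous : ∀ i, (H i).IsHomogeneous d
  isRelPrime : IsRelPrime
    (MvPolynomial.map (algebraMap A (IsLocalRing.ResidueField A)) (H 0))
    (MvPolynomial.map (algebraMap A (IsLocalRing.ResidueField A)) (H 1))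
  exists_eq_smul : ∃ c : K, c ≠ 0 ∧ ∀ v : Fin 2 → K, formMap H v = c • homLift f v

theorem HasGoodReduction.exists_isGoodLift {f : RatFunc K} (hf : HasGoodReduction A f) :
    ∃ H d, IsGoodLift (A := A) f H d := by
  obtain ⟨c, F, G, hc, hF, hG, -, hrel⟩ := hf
  have hinj : Function.Injective (algebraMap A K) := Subtype.val_injective
  have hhom : ∀ q : K[X],
      (MvPolynomial.C c * q.homogenize (ratDegree f)).IsHomogeneous (ratDegree f) := by
    intro q
    simpa using (MvPolynomial.isHomogeneous_C _ c).mul (isHomogeneous_homogenize q)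
  refine ⟨![F, G], ratDegree f, ?_, hrel, c, hc, ?_⟩
  · intro i
    refine MvPolynomial.IsHomogeneous.of_map hinj ?_
    fin_cases i
    · exact hF ▸ hhom f.num
    · exact hG ▸ hhom f.denom
  · intro v
    ext i
    simp only [formMap, Pi.smul_apply, smul_eq_mul]
    rw [MvPolynomial.aeval_def, ← MvPolynomial.eval_map]
    fin_cases i
    · simp [homLift, hF]
    · simp [homLift, hG]

namespace IsGoodLift

variable {f : RatFunc K} {H : Fin 2 → MvPolynomial (Fin 2) A} {d : ℕ} (hH : IsGoodLift f H d)

include hH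

theorem isRep_act {P : P1 K} {v : Fin 2 → K} (hv : IsRep P v) :
    IsRep (act f P) (formMap H v) := by
  obtain ⟨c, hc, h⟩ := hH.exists_eq_smul
  rw [h]
  exact (hv.act f).smul hc

theorem isRep_act_iterate {P : P1 K} {v : Fin 2 → K} (hv : IsRep P v) (n : ℕ) :
    IsRep ((act f)^[n] P) ((formMap H)^[n] v) := by
  induction n with
  | zero => exact hv
  | succ n ih =>
    rw [Function.iterate_succ_apply', Function.iterate_succ_apply']
    exact hH.isRep_act ih

theorem exists_isUnit_formMap {v : Fin 2 → A} (hv : ∃ i, IsUnit (v i)) :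
    ∃ i, IsUnit (formMap H v i) := by
  let φ : A →ₐ[A] IsLocalRing.ResidueField A := Algebra.ofId _ _
  have hφ : ∀ x, φ x ≠ 0 ↔ IsUnit x := fun x => IsLocalRing.residue_ne_zero_iff_isUnit x
  obtain ⟨i, hi⟩ := hv
  have h1 : φ ∘ v ≠ 0 := fun h => (hφ _).2 hi (congrFun h i)
  have h2 := formMap_ne_zero H hH.isHomogeneous hH.isRelPrime h1
  rw [formMap_comp_algHom] at h2
  obtain ⟨j, hj⟩ := Function.ne_iff.1 h2
  exact ⟨j, (hφ _).1 hj⟩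

theorem exists_isUnit_formMap_iterate {v : Fin 2 → A} (hv : ∃ i, IsUnit (v i)) (n : ℕ) :
    ∃ i, IsUnit ((formMap H)^[n] v i) := by
  induction n with
  | zero => exact hv
  | succ n ih =>
    rw [Function.iterate_succ_apply']
    exact hH.exists_isUnit_formMap ih

end IsGoodLift

/-- The vector of `K²` underlying a vector with integral coordinates. -/
def toVec (v : Fin 2 → A) : Fin 2 → K := fun i => v i

theorem formMap_toVec (H : Fin 2 → MvPolynomial (Fin 2) A) (v : Fin 2 → A) :
    formMap H (toVec v) = toVec (formMap H v) :=
  formMap_comp_algHom H (Algebra.ofId A K) v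

theorem formMap_iterate_toVec (H : Fin 2 → MvPolynomial (Fin 2) A) (n : ℕ) (v : Fin 2 → A) :
    (formMap H)^[n] (toVec v) = toVec ((formMap H)^[n] v) :=
  formMap_iterate_comp_algHom H (Algebra.ofId A K) n v

theorem det2_toVec (v w : Fin 2 → A) : det2 (toVec v) (toVec w) = (det2 v w : A) := by
  simp [det2, toVec]

variable (hA : ∀ x : K, x ∈ A ↔ ‖x‖ ≤ 1)

include hA

theorem norm_toVec_eq_one {v : Fin 2 → A} (hv : ∃ i, IsUnit (v i)) : ‖toVec v‖ = 1 := by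
  obtain ⟨i, hi⟩ := hv
  refine le_antisymm ((pi_norm_le_iff_of_nonneg zero_le_one).2 fun j => norm_coe_le_one hA _) ?_
  rw [← (isUnit_iff_norm_eq_one hA).1 hi]
  exact norm_le_pi_norm (toVec v) i

theorem exists_isRep_toVec (P : P1 K) :
    ∃ v : Fin 2 → A, (∃ i, IsUnit (v i)) ∧ IsRep P (toVec v) := by
  obtain ⟨i, hi⟩ : ∃ i, ∀ j, ‖P.rep j‖ ≤ ‖P.rep i‖ := Finite.exists_max fun i => ‖P.rep i‖
  have h0 : P.rep i ≠ 0 := by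
    intro h0
    refine P.rep_nonzero (funext fun j => ?_)
    have := hi j
    rw [h0, norm_zero] at this
    exact norm_le_zero_iff.1 this
  have hmem : ∀ j, (P.rep i)⁻¹ * P.rep j ∈ A := by
    intro j
    rw [hA, norm_mul, norm_inv, inv_mul_le_iff₀ (norm_pos_iff.2 h0), mul_one]
    exact hi j
  refine ⟨fun j => ⟨_, hmem j⟩, ⟨i, (isUnit_iff_norm_eq_one hA).2 ?_⟩,
    (isRep_rep P).smul (inv_ne_zero h0)⟩
  simp [h0]

theorem chordal_eq_norm_det2 {P Q : P1 K} {v w : Fin 2 → A} (hv : ∃ i, IsUnit (v i))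
    (hw : ∃ i, IsUnit (w i)) (hP : IsRep P (toVec v)) (hQ : IsRep Q (toVec w)) :
    chordal P Q = ‖((det2 v w : A) : K)‖ := by
  rw [chordal_eq hP hQ, norm_toVec_eq_one hA hv, norm_toVec_eq_one hA hw, det2_toVec, mul_one,
    div_one]

theorem IsGoodLift.chordal_act_le {f : RatFunc K} {H : Fin 2 → MvPolynomial (Fin 2) A} {d : ℕ}
    (hH : IsGoodLift f H d) (P Q : P1 K) : chordal (act f P) (act f Q) ≤ chordal P Q := by
  obtain ⟨v, hv, hP⟩ := exists_isRep_toVec hA P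
  obtain ⟨w, hw, hQ⟩ := exists_isRep_toVec hA Q
  have hP' := hH.isRep_act hP
  have hQ' := hH.isRep_act hQ
  rw [formMap_toVec] at hP' hQ'
  rw [chordal_eq_norm_det2 hA hv hw hP hQ, chordal_eq_norm_det2 hA
    (hH.exists_isUnit_formMap hv) (hH.exists_isUnit_formMap hw) hP' hQ', ← dvd_iff_norm_le hA]
  obtain ⟨i, hi⟩ := hv
  exact det2_dvd_det2_formMap H hH.isHomogeneous hi

theorem norm_aeval_sub_coeff_zero_le (P : A[X]) {t : K} (ht : ‖t‖ ≤ 1) :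
    ‖aeval t P - (P.coeff 0 : K)‖ ≤ ‖t‖ := by
  have h := norm_aeval_sub_le hA P ht (y := 0) (by simp)
  rw [sub_zero] at h
  convert h using 3
  exact coeff_zero_eq_aeval_zero' P

variable [IsUltrametricDist K]

theorem norm_aeval_eq_one {P : A[X]} (hP : ‖(P.coeff 0 : K)‖ = 1) {t : K} (ht : ‖t‖ < 1) :
    ‖aeval t P‖ = 1 := by
  have h := (norm_aeval_sub_coeff_zero_le hA P ht.le).trans_lt ht
  have h1 : aeval t P = (aeval t P - (P.coeff 0 : K)) + (P.coeff 0 : K) := by ring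
  rw [h1, IsUltrametricDist.norm_add_eq_max_of_norm_ne_norm (by rw [hP]; exact h.ne), hP,
    max_eq_right h.le]

theorem norm_aeval_le_max (P : A[X]) {t : K} (ht : ‖t‖ ≤ 1) :
    ‖aeval t P‖ ≤ max ‖(P.coeff 0 : K)‖ ‖t‖ := by
  have h1 : aeval t P = (P.coeff 0 : K) + (aeval t P - (P.coeff 0 : K)) := by ring
  rw [h1]
  exact (IsUltrametricDist.norm_add_le_max _ _).trans
    (max_le_max le_rfl (norm_aeval_sub_coeff_zero_le hA P ht))

/-- An iterate of `f` fixing the residue class of `[w]` acts on it, in the coordinate `t` of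
`[w + t e]`, as a quotient of two integral polynomials. -/
theorem IsGoodLift.exists_chart {f : RatFunc K} {H : Fin 2 → MvPolynomial (Fin 2) A} {d : ℕ}
    (hH : IsGoodLift f H d) {w : Fin 2 → A} (hw : ∃ i, IsUnit (w i)) {N : ℕ}
    (hN : ∀ i, ‖(((formMap H)^[N] w i : A) : K) - w i‖ < 1) :
    ∃ (e : Fin 2 → A) (L U : A[X]), IsUnit (det2 w e) ∧ ‖(L.coeff 0 : K)‖ = 1 ∧
      ‖(U.coeff 0 : K)‖ < 1 ∧ ∀ (t : K) (Q : P1 K), ‖t‖ < 1 → IsRep Q (toVec w + t • toVec e) →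
        IsRep ((act f)^[N] Q) (toVec w + (aeval t U / aeval t L) • toVec e) := by
  obtain ⟨e, he⟩ : ∃ e : Fin 2 → A, IsUnit (det2 w e) := by
    obtain ⟨i, hi⟩ := hw
    fin_cases i
    · exact ⟨![0, 1], by simpa [det2] using hi⟩
    · exact ⟨![1, 0], by simpa [det2] using hi.neg⟩
  obtain ⟨D, hD⟩ := he.exists_left_inv
  have hDK : (D : K) * (det2 w e : A) = 1 := by exact_mod_cast hD
  let Cw : Fin 2 → A[X] := fun i => C (w i)
  let Ce : Fin 2 → A[X] := fun i => C (e i)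
  -- `Z` is the image of the generic point `w + X e`; by Cramer's rule `L` and `U` are its
  -- coordinates in the basis `w`, `e`, with `D` the inverse of the determinant.
  let Z : Fin 2 → A[X] := (formMap H)^[N] (Cw + (X : A[X]) • Ce)
  let L : A[X] := C D * det2 Z Ce
  let U : A[X] := C D * det2 Cw Z
  let z : Fin 2 → A := (formMap H)^[N] w
  have hZ0 : ∀ i, (Z i).coeff 0 = z i := by
    have h1 := formMap_iterate_comp_algHom H (aeval (0 : A)) N (Cw + (X : A[X]) • Ce)
    have h2 : (aeval (0 : A)) ∘ (Cw + (X : A[X]) • Ce) = w := by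
      ext i
      simp [Cw, Ce]
    rw [h2] at h1
    intro i
    rw [coeff_zero_eq_aeval_zero]
    exact (congrFun h1 i).symm
  have hL0 : L.coeff 0 = D * det2 z e := by
    simp only [L, mul_coeff_zero, coeff_C_zero, det2, coeff_sub, hZ0, Ce]
  have hU0 : U.coeff 0 = D * det2 w z := by
    simp only [U, mul_coeff_zero, coeff_C_zero, det2, coeff_sub, hZ0, Cw]
  have hzw : ∀ i, z i - w i ∈ IsLocalRing.maximalIdeal A := fun i =>
    (mem_maximalIdeal_iff_norm_lt_one hA).2 (by exact_mod_cast hN i)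
  have hLn : ‖(L.coeff 0 : K)‖ = 1 := by
    rw [← isUnit_iff_norm_eq_one hA, hL0]
    have h1 : D * det2 z e - 1 ∈ IsLocalRing.maximalIdeal A := by
      have h2 : D * det2 z e - 1 = D * e 1 * (z 0 - w 0) - D * e 0 * (z 1 - w 1) := by
        rw [← hD]
        simp only [det2]
        ring
      rw [h2]
      exact sub_mem (Ideal.mul_mem_left _ _ (hzw 0)) (Ideal.mul_mem_left _ _ (hzw 1))
    by_contra h3
    have h4 := sub_mem ((IsLocalRing.mem_maximalIdeal _).2 h3) h1
    rw [sub_sub_cancel] at h4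
    exact (IsLocalRing.mem_maximalIdeal _).1 h4 isUnit_one
  refine ⟨e, L, U, he, hLn, ?_, ?_⟩
  · rw [← mem_maximalIdeal_iff_norm_lt_one hA, hU0]
    have h2 : D * det2 w z = D * w 0 * (z 1 - w 1) - D * w 1 * (z 0 - w 0) := by
      simp only [det2]
      ring
    rw [h2]
    exact sub_mem (Ideal.mul_mem_left _ _ (hzw 1)) (Ideal.mul_mem_left _ _ (hzw 0))
  · intro t Q ht hQ
    have h1 := hH.isRep_act_iterate hQ N
    have hLt : aeval t L ≠ 0 := norm_ne_zero_iff.1 (by rw [norm_aeval_eq_one hA hLn ht]; simp)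
    let φ : A[X] →ₐ[A] K := aeval t
    have h2 : φ ∘ (Cw + (X : A[X]) • Ce) = toVec w + t • toVec e := by
      ext i
      simp only [Function.comp_apply, Pi.add_apply, Pi.smul_apply, smul_eq_mul, map_add, map_mul,
        φ, aeval_X, Cw, Ce, aeval_C, toVec]
      rfl
    rw [← h2, formMap_iterate_comp_algHom] at h1
    have h3 := h1.smul (inv_ne_zero hLt)
    convert h3 using 1
    have h4 : ∀ i, Z i = L * C (w i) + U * C (e i) := by
      intro i
      have h5 := congrFun (det2_smul_eq Cw Ce Z) i
      simp only [Pi.add_apply, Pi.smul_apply, smul_eq_mul] at h5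
      have h6 : C D * det2 Cw Ce = 1 := by
        simp only [det2, Cw, Ce, ← C_mul, ← C_sub]
        rw [← C_1, ← hD]
        rfl
      calc Z i = C D * (det2 Cw Ce * Z i) := by rw [← mul_assoc, h6, one_mul]
        _ = L * C (w i) + U * C (e i) := by
          rw [h5]
          simp only [L, U, Cw, Ce]
          ring
    ext i
    have h7 : (φ ∘ Z) i = aeval t L * toVec w i + aeval t U * toVec e i := by
      rw [Function.comp_apply, h4 i]
      simp only [φ, map_add, map_mul, aeval_C]
      rfl
    change toVec w i + aeval t U / aeval t L * toVec e i = (aeval t L)⁻¹ * (φ ∘ Z) i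
    rw [h7]
    field_simp

end GoodLift

end DynP1

namespace DynP1

open Polynomial

/-! ### Contraction when the linear coefficient is not a unit -/

section Contraction

variable {K : Type*} [NormedField K] [IsUltrametricDist K] {A : ValuationSubring K}
  (hA : ∀ x : K, x ∈ A ↔ ‖x‖ ≤ 1) {L U : A[X]} (hL : ‖(L.coeff 0 : K)‖ = 1)

include hA hL

/-- On the disc of radius `r`, `U` has values of norm at most `r` and is `r`-Lipschitz, while `L`
has norm one and is `1`-Lipschitz; the quotient rule for differences combines these. -/
theorem norm_div_sub_div_le {r : ℝ} (hr1 : r < 1) (hU0 : ‖(U.coeff 0 : K)‖ ≤ r)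
    (hU1 : ‖(U.coeff 1 : K)‖ ≤ r) {s t : K} (hs : ‖s‖ ≤ r) (ht : ‖t‖ ≤ r) :
    ‖aeval t U / aeval t L‖ ≤ r ∧
      ‖aeval s U / aeval s L - aeval t U / aeval t L‖ ≤ r * ‖s - t‖ := by
  have hr0 : 0 ≤ r := (norm_nonneg _).trans hs
  have hs1 := hs.trans hr1.le
  have ht1 := ht.trans hr1.le
  have hLs := norm_aeval_eq_one hA hL (hs.trans_lt hr1)
  have hLt := norm_aeval_eq_one hA hL (ht.trans_lt hr1)
  have hLs0 : aeval s L ≠ 0 := norm_ne_zero_iff.1 (by rw [hLs]; simp)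
  have hLt0 : aeval t L ≠ 0 := norm_ne_zero_iff.1 (by rw [hLt]; simp)
  have hUt : ‖aeval t U‖ ≤ r := (norm_aeval_le_max hA U ht1).trans (max_le hU0 ht)
  have hUst : ‖aeval s U - aeval t U‖ ≤ r * ‖s - t‖ := by
    have hdiv : ∀ x : K, aeval x U = aeval x U.divX * x + (U.coeff 0 : K) := by
      intro x
      conv_lhs => rw [← divX_mul_X_add U]
      rw [map_add, map_mul, aeval_X, aeval_C]
      rfl
    have h1 : aeval s U - aeval t U
        = (s - t) * aeval s U.divX + t * (aeval s U.divX - aeval t U.divX) := by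
      rw [hdiv s, hdiv t]
      ring
    have h2 : ‖aeval s U.divX‖ ≤ r := by
      refine (norm_aeval_le_max hA _ hs1).trans (max_le ?_ hs)
      rwa [coeff_divX]
    rw [h1]
    refine (IsUltrametricDist.norm_add_le_max _ _).trans (max_le ?_ ?_)
    · rw [norm_mul, mul_comm]
      gcongr
    · rw [norm_mul]
      exact mul_le_mul ht (norm_aeval_sub_le hA _ hs1 ht1) (norm_nonneg _) hr0
  refine ⟨by rwa [norm_div, hLt, div_one], ?_⟩
  have h3 : aeval s U / aeval s L - aeval t U / aeval t L
      = ((aeval s U - aeval t U) * aeval t L + -(aeval t U * (aeval s L - aeval t L)))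
        / (aeval s L * aeval t L) := by
    field_simp
    ring
  rw [h3, norm_div, norm_mul, hLs, hLt, mul_one, div_one]
  refine (IsUltrametricDist.norm_add_le_max _ _).trans (max_le ?_ ?_)
  · rwa [norm_mul, hLt, mul_one]
  · rw [norm_neg, norm_mul]
    exact mul_le_mul hUt (norm_aeval_sub_le hA _ hs1 ht1) (norm_nonneg _) hr0

/-- Banach's fixed point theorem on a closed disc with `r` strictly between both coefficient norms
and `1`. -/
theorem exists_attracting_fixedPoint [CompleteSpace K] (hU0 : ‖(U.coeff 0 : K)‖ < 1)
    (hU1 : ‖(U.coeff 1 : K)‖ < 1) :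
    ∃ (r : ℝ) (t : K), 0 < r ∧ r < 1 ∧ ‖t‖ ≤ r ∧ aeval t U / aeval t L = t ∧
      ∀ s : K, ‖s‖ ≤ r → ‖aeval s U / aeval s L - t‖ ≤ r * ‖s - t‖ := by
  obtain ⟨r, hr, hr1⟩ := exists_between (max_lt hU0 hU1)
  have hr0 : 0 < r := (le_max_of_le_left (norm_nonneg _)).trans_lt hr
  have hU0' := (le_max_left _ _).trans hr.le
  have hU1' := (le_max_right _ _).trans hr.le
  let h : K → K := fun t => aeval t U / aeval t L
  have hmaps : Set.MapsTo h (Metric.closedBall 0 r) (Metric.closedBall 0 r) := by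
    intro t ht
    rw [mem_closedBall_zero_iff] at ht ⊢
    exact (norm_div_sub_div_le hA hL hr1 hU0' hU1' ht ht).1
  have hcon : ContractingWith ⟨r, hr0.le⟩ (hmaps.restrict h _ _) := by
    refine ⟨by exact_mod_cast hr1, LipschitzWith.of_dist_le_mul fun s t => ?_⟩
    have hs := mem_closedBall_zero_iff.1 s.2
    have ht := mem_closedBall_zero_iff.1 t.2
    have := (norm_div_sub_div_le hA hL hr1 hU0' hU1' hs ht).2
    rw [Subtype.dist_eq, Subtype.dist_eq, dist_eq_norm, dist_eq_norm]
    exact this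
  obtain ⟨t, ht, hfix, -⟩ := hcon.exists_fixedPoint' Metric.isClosed_closedBall.isComplete hmaps
    (Metric.mem_closedBall_self hr0.le) (edist_ne_top _ _)
  rw [mem_closedBall_zero_iff] at ht
  have hfix' : aeval t U / aeval t L = t := hfix
  refine ⟨r, t, hr0, hr1, ht, hfix', fun s hs => ?_⟩
  conv_lhs => rw [← hfix']
  exact (norm_div_sub_div_le hA hL hr1 hU0' hU1' hs ht).2

end Contraction

/-! ### Orbits in a periodic residue class -/

section ResidueClass

variable {K : Type*} [NontriviallyNormedField K] {A : ValuationSubring K}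
  (hA : ∀ x : K, x ∈ A ↔ ‖x‖ ≤ 1)
  {f : RatFunc K} {H : Fin 2 → MvPolynomial (Fin 2) A} {d : ℕ} (hH : IsGoodLift f H d)
  {w : Fin 2 → A} (hw : ∃ i, IsUnit (w i)) {P : P1 K} (hP : IsRep P (toVec w))

include hA in
theorem exists_isUnit_add_smul {w : Fin 2 → A} (hw : ∃ i, IsUnit (w i)) {t : A}
    (ht : ‖(t : K)‖ < 1) (e : Fin 2 → A) : ∃ i, IsUnit ((w + t • e) i) := by
  obtain ⟨i, hi⟩ := hw
  refine ⟨i, ?_⟩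
  by_contra h
  have h1 := (IsLocalRing.mem_maximalIdeal _).2 h
  have h2 := Ideal.mul_mem_right (e i) _ ((mem_maximalIdeal_iff_norm_lt_one hA).2 ht)
  have h3 := sub_mem h1 h2
  rw [Pi.add_apply, Pi.smul_apply, smul_eq_mul, add_sub_cancel_right] at h3
  exact (IsLocalRing.mem_maximalIdeal _).1 h3 hi

theorem toVec_add_smul (w e : Fin 2 → A) (t : A) :
    toVec (w + t • e) = toVec w + (t : K) • toVec e := by
  ext i
  simp [toVec]

include hA hw hP in
theorem sameResidueClass_of_isRep {e : Fin 2 → A} {t : A} (ht : ‖(t : K)‖ < 1) {z : P1 K}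
    (hz : IsRep z (toVec (w + t • e))) : SameResidueClass A P z := by
  have hw' := exists_isUnit_add_smul hA hw ht e
  have hne : ∀ v : Fin 2 → A, (∃ i, IsUnit (v i)) →
      (fun j => IsLocalRing.residue A (v j)) ≠ 0 := by
    rintro v ⟨i, hi⟩ h
    exact (IsLocalRing.residue_ne_zero_iff_isUnit _).2 hi (congrFun h i)
  refine ⟨Projectivization.mk _ _ (hne w hw), ⟨w, hP.ne_zero, hne w hw, hP.2, rfl⟩,
    w + t • e, hz.ne_zero, hne _ hw', hz.2, ?_⟩
  congr 1
  ext j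
  have : IsLocalRing.residue A t = 0 :=
    (IsLocalRing.residue_eq_zero_iff _).2 ((mem_maximalIdeal_iff_norm_lt_one hA).2 ht)
  simp [this]

variable [IsUltrametricDist K]

include hA hH hw hP

/-- In a periodic residue class which contains no attracting periodic point, the orbit of a point
is interpolated, along an arithmetic progression, by sequences with small differences. -/
theorem IsGoodLift.exists_diffBounded_isRep [CompleteSpace K] {p : ℕ} (hp0 : (p : K) ≠ 0)
    (hp1 : ‖(p : K)‖ < 1) (hpp : 0 < p)
    (hfin : ∀ a : A, ‖(a : K)‖ = 1 → ∃ M > 0, ‖(a : K) ^ M - 1‖ < 1) {N : ℕ} (hN0 : 0 < N)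
    (hN : ∀ i, ‖(((formMap H)^[N] w i : A) : K) - w i‖ < 1)
    (hatt : ∀ z, IsAttractingPeriodic f z → ¬ SameResidueClass A P z) :
    ∃ M > 0, ∀ k, ∃ v : ℕ → Fin 2 → K, (∀ i, DiffBounded (‖(p : K)‖ ^ 2) fun n => v n i) ∧
      ∀ n, IsRep ((act f)^[M * k * n] P) (v n) := by
  obtain ⟨e, L, U, he, hL, hU0, hstep⟩ := hH.exists_chart hA hw hN
  -- Otherwise the contraction has a fixed point `t`, and `[w + t e]` is an attracting periodic
  -- point in the residue class of `P`.
  have hU1 : ‖(U.coeff 1 : K)‖ = 1 := by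
    refine le_antisymm (norm_coe_le_one hA _) ?_
    by_contra! hU1
    obtain ⟨r, t, hr0, hr1, ht, hfix, hcon⟩ := exists_attracting_fixedPoint hA hL hU0 hU1
    have hrep : ∀ s : K, ‖s‖ ≤ r → ∃ s' : A, (s' : K) = s ∧
        ∃ Q : P1 K, IsRep Q (toVec (w + s' • e)) := by
      intro s hs
      refine ⟨⟨s, (hA s).2 (hs.trans hr1.le)⟩, rfl, _, ?_, rfl⟩
      refine norm_ne_zero_iff.1 ?_
      rw [norm_toVec_eq_one hA (exists_isUnit_add_smul hA hw (hs.trans_lt hr1) e)]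
      exact one_ne_zero
    have hdet : ∀ s s' : A, ‖(s : K)‖ ≤ r → ‖(s' : K)‖ ≤ r → ∀ Q Q' : P1 K,
        IsRep Q (toVec (w + s • e)) → IsRep Q' (toVec (w + s' • e)) →
        chordal Q Q' = ‖(s : K) - s'‖ := by
      intro s s' hs hs' Q Q' hQ hQ'
      rw [chordal_eq_norm_det2 hA (exists_isUnit_add_smul hA hw (hs.trans_lt hr1) e)
        (exists_isUnit_add_smul hA hw (hs'.trans_lt hr1) e) hQ hQ']
      have h1 : det2 (w + s • e) (w + s' • e) = (s' - s) * det2 w e := by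
        simp only [det2, Pi.add_apply, Pi.smul_apply, smul_eq_mul]
        ring
      rw [h1]
      push_cast
      rw [norm_mul, (isUnit_iff_norm_eq_one hA).1 he, mul_one, norm_sub_rev]
    obtain ⟨t, rfl, z, hz⟩ := hrep t ht
    have hzN : (act f)^[N] z = z := by
      have h1 := hstep t z (ht.trans_lt hr1) (by rwa [← toVec_add_smul])
      rw [hfix, ← toVec_add_smul] at h1
      exact h1.eq hz
    refine hatt z ⟨⟨N, hN0, hzN⟩, ?_⟩
      (sameResidueClass_of_isRep hA hw hP (ht.trans_lt hr1) hz)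
    refine norm_multiplier_lt_one (hH.chordal_act_le hA) hzN fun η hη => ?_
    obtain ⟨x, hx0, hx⟩ := NormedField.exists_norm_lt K (lt_min hη hr0)
    have hs : ‖(t : K) + x‖ ≤ r := (IsUltrametricDist.norm_add_le_max _ _).trans
      (max_le ht (hx.le.trans (min_le_right _ _)))
    obtain ⟨s, hsx, Q, hQ⟩ := hrep _ hs
    rw [← hsx] at hs
    have hst : ‖(s : K) - t‖ = ‖x‖ := by rw [hsx, add_sub_cancel_left]
    have hQz := hdet s t hs ht Q z hQ hz
    refine ⟨Q, by rw [hQz, hst]; exact hx.trans_le (min_le_left _ _), ?_⟩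
    have h1 := hstep s Q (hs.trans_lt hr1) (by rwa [← toVec_add_smul])
    have h2 := hcon s hs
    have h3 : ‖aeval (s : K) U / aeval (s : K) L‖ ≤ r := by
      have h4 : aeval (s : K) U / aeval (s : K) L
          = (aeval (s : K) U / aeval (s : K) L - t) + t := by ring
      rw [h4]
      refine (IsUltrametricDist.norm_add_le_max _ _).trans (max_le (h2.trans ?_) ht)
      rw [hst]
      have := hx.le.trans (min_le_right _ _)
      nlinarith [norm_nonneg x]
    obtain ⟨s', hs', -⟩ := hrep _ h3
    rw [← hs'] at h1 h2 h3
    rw [← toVec_add_smul] at h1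
    rw [hdet s' t h3 ht _ z h1 hz, hQz]
    refine h2.trans_lt ?_
    rw [hst]
    exact mul_lt_of_lt_one_left hx0 hr1
  obtain ⟨M, hM, hMk⟩ := exists_diffBounded_iterate hA hp0 hp1 hpp hfin hL hU0 hU1
    (h := fun t => aeval t U / aeval t L) fun _ => rfl
  set h : K → K := fun t => aeval t U / aeval t L with hh
  have hlt : ∀ n, ‖h^[n] 0‖ < 1 := by
    intro n
    induction n with
    | zero => simp
    | succ n ih =>
      rw [Function.iterate_succ_apply', hh]
      rw [norm_div, norm_aeval_eq_one hA hL ih, div_one]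
      exact (norm_aeval_le_max hA U ih.le).trans_lt (max_lt hU0 ih)
  have horb : ∀ n, IsRep ((act f)^[N * n] P) (toVec w + h^[n] 0 • toVec e) := by
    intro n
    induction n with
    | zero => simpa using hP
    | succ n ih =>
      rw [Nat.mul_succ, Nat.add_comm, Function.iterate_add_apply, Function.iterate_succ_apply']
      exact hstep _ _ (hlt n) ih
  refine ⟨N * M, by positivity, fun k =>
    ⟨fun n => toVec w + h^[M * k * n] 0 • toVec e, fun i => ?_, fun n => ?_⟩⟩
  · exact (DiffBounded.const (by positivity) (toVec w i)).add (by positivity)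
      ((hMk k).mul (by positivity) (DiffBounded.const (by positivity) (toVec e i)))
  · rw [mul_assoc, mul_assoc, ← mul_assoc M]
    exact horb _

end ResidueClass

end DynP1

namespace DynP1

open Polynomial

/-! ### The residue field of `ℂ_[p]` is algebraic over its prime field -/

section PadicComplex

variable (p : ℕ) [hp : Fact p.Prime]

theorem mem_padicComplexInt_iff (x : ℂ_[p]) : x ∈ 𝓞_ℂ_[p] ↔ ‖x‖ ≤ 1 := by
  rw [PadicComplex.norm_eq_norm]
  exact (Valued.toNormedField.norm_le_one_iff (L := ℂ_[p]) (Γ₀ := NNReal)).symm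

theorem padicComplex_norm_p : ‖(p : ℂ_[p])‖ = (p : ℝ)⁻¹ := by
  have h := PadicComplex.norm_extends' p (p : ℚ_[p])
  rw [Padic.norm_p] at h
  rw [← h]
  congr 1
  norm_cast

theorem padicComplex_norm_natCast_eq_one {m : ℕ} (hm : ¬ p ∣ m) : ‖(m : ℂ_[p])‖ = 1 := by
  have h := PadicComplex.norm_extends' p (m : ℚ_[p])
  have h1 : ‖(m : ℚ_[p])‖ = 1 := by
    rw [Padic.norm_natCast_eq_one_iff]
    exact ((Nat.Prime.coprime_iff_not_dvd hp.out).2 hm)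
  rw [h1] at h
  rw [← h]
  congr 1
  norm_cast

/-- An element of norm at most one of the algebraic closure of `ℚ_[p]` is, up to elements of norm
less than one, a root of a monic polynomial with integer coefficients. -/
theorem exists_monic_norm_aeval_lt_one {y : PadicAlgCl p} (hy : ‖y‖ ≤ 1) :
    ∃ g : ℤ[X], g.Monic ∧ ‖aeval y g‖ < 1 := by
  have hint : IsIntegral ℚ_[p] y := (PadicAlgCl.isAlgebraic p).isAlgebraic y |>.isIntegral
  set q := minpoly ℚ_[p] y with hq
  have hqm : q.Monic := minpoly.monic hint
  -- The norm of `y` is the spectral value of its minimal polynomial.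
  have hcoeff : ∀ i, ‖q.coeff i‖ ≤ 1 := (spectralValue_le_one_iff hqm).1 hy
  have hc : ∀ i, ∃ c : ℤ, ‖q.coeff i - c‖ < 1 := by
    intro i
    let a : ℤ_[p] := ⟨q.coeff i, hcoeff i⟩
    obtain ⟨n, -, hn⟩ := PadicInt.exists_mem_range a
    have h1 := PadicInt.mem_nonunits.1 ((IsLocalRing.mem_maximalIdeal _).1 hn)
    rw [PadicInt.norm_def, PadicInt.coe_sub, PadicInt.coe_natCast] at h1
    exact ⟨n, by exact_mod_cast h1⟩
  choose c hc using hc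
  set n := q.natDegree
  refine ⟨X ^ n + ∑ i ∈ Finset.range n, C (c i) * X ^ i, monic_X_pow_add ?_, ?_⟩
  · refine (degree_sum_le _ _).trans_lt ?_
    refine (Finset.sup_lt_iff (WithBot.bot_lt_coe n)).2 fun i hi => ?_
    exact (degree_C_mul_X_pow_le _ _).trans_lt (WithBot.coe_lt_coe.2 (Finset.mem_range.1 hi))
  · have h0 : aeval y q = 0 := minpoly.aeval _ _
    rw [hqm.as_sum] at h0
    have h1 : aeval y (X ^ n + ∑ i ∈ Finset.range n, C (c i) * X ^ i : ℤ[X])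
        = -∑ i ∈ Finset.range n, algebraMap ℚ_[p] (PadicAlgCl p) (q.coeff i - c i) * y ^ i := by
      rw [← sub_eq_zero, ← h0]
      simp only [map_add, map_pow, map_sum, map_mul, aeval_X, aeval_C, map_sub, sub_mul,
        Finset.sum_sub_distrib, map_intCast, eq_intCast]
      ring
    rw [h1, norm_neg]
    refine Finset.sum_induction _ (fun x => ‖x‖ < 1)
      (fun x x' hx hx' => (IsUltrametricDist.norm_add_le_max _ _).trans_lt (max_lt hx hx'))
      (by simp) fun i _ => ?_
    rw [norm_mul, norm_pow, norm_algebraMap']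
    exact mul_lt_one_of_nonneg_of_lt_one_left (norm_nonneg _) (hc i)
      (pow_le_one₀ (norm_nonneg _) hy)

/-- An algebraic `y` within distance one of `x` has the same residue, so a monic integer polynomial
small at `y` is small at `x`. -/
theorem residueField_isIntegralElem (x : IsLocalRing.ResidueField 𝓞_ℂ_[p]) :
    (Int.castRingHom (IsLocalRing.ResidueField 𝓞_ℂ_[p])).IsIntegralElem x := by
  obtain ⟨x, rfl⟩ := IsLocalRing.residue_surjective x
  obtain ⟨y, hxy⟩ := Metric.denseRange_iff.1
    (UniformSpace.Completion.denseRange_coe (α := PadicAlgCl p)) (x : ℂ_[p]) 1 one_pos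
  rw [dist_eq_norm] at hxy
  have hx := (mem_padicComplexInt_iff p _).1 x.2
  have hy : ‖(y : ℂ_[p])‖ ≤ 1 := by
    have : (y : ℂ_[p]) = x + -(x - y) := by ring
    rw [this]
    refine (IsUltrametricDist.norm_add_le_max _ _).trans (max_le hx ?_)
    rw [norm_neg]
    exact hxy.le
  obtain ⟨g, hg, hgy⟩ := exists_monic_norm_aeval_lt_one p
    (y := y) (by rwa [PadicComplex.norm_extends] at hy)
  refine ⟨g, hg, ?_⟩
  have h1 : aeval (y : ℂ_[p]) g = ((aeval y g : PadicAlgCl p) : ℂ_[p]) := by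
    rw [PadicComplex.coe_eq, PadicComplex.coe_eq, aeval_algebraMap_apply]
  have h2 : ‖aeval (y : ℂ_[p]) g‖ < 1 := by rwa [h1, PadicComplex.norm_extends]
  have h3 : ‖aeval (x : ℂ_[p]) g - aeval (y : ℂ_[p]) g‖ ≤ ‖(x : ℂ_[p]) - y‖ := by
    have := norm_aeval_sub_le (mem_padicComplexInt_iff p) (g.map (algebraMap ℤ 𝓞_ℂ_[p])) hx hy
    simpa only [aeval_map_algebraMap] using this
  have h4 : ‖aeval (x : ℂ_[p]) g‖ < 1 := by
    rw [← sub_add_cancel (aeval (x : ℂ_[p]) g) (aeval (y : ℂ_[p]) g)]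
    exact (IsUltrametricDist.norm_add_le_max _ _).trans_lt (max_lt (h3.trans_lt hxy) h2)
  have h5 : aeval (x : ℂ_[p]) g = ((aeval x g : 𝓞_ℂ_[p]) : ℂ_[p]) :=
    aeval_algebraMap_apply ℂ_[p] x g
  rw [h5, ← mem_maximalIdeal_iff_norm_lt_one (mem_padicComplexInt_iff p),
    ← IsLocalRing.residue_eq_zero_iff] at h4
  rw [← h4, aeval_def, hom_eval₂]
  congr 1

end PadicComplex

end DynP1

namespace DynP1

/-! ### From progressions of times to a finite union -/

section Progressions

/-- A set of natural numbers which eventually meets each progression of difference `M` in a finite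
set or contains it is a finite union of progressions. -/
theorem exists_finset_progressions {s : Set ℕ} {m M : ℕ} (hM : 0 < M)
    (h : ∀ l, m ≤ l → (∀ n, l + M * n ∈ s) ∨ {n | l + M * n ∈ s}.Finite) :
    ∃ T : Finset (ℕ × ℕ), ∀ x, x ∈ s ↔ ∃ kl ∈ T, ∃ n, x = n * kl.1 + kl.2 := by
  classical
  let G : Finset ℕ := (Finset.Ico m (m + M)).filter fun l => ∀ n, l + M * n ∈ s
  let B : Set ℕ := {x ∈ s | ∀ l ∈ G, ∀ n, x ≠ l + M * n}
  have hB : B.Finite := by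
    refine ((Set.finite_Iio m).union ((Finset.finite_toSet
      ((Finset.Ico m (m + M)).filter fun l => ¬ ∀ n, l + M * n ∈ s)).biUnion (t := fun l =>
        (fun n => l + M * n) '' {n | l + M * n ∈ s}) fun l hl => ?_)).subset ?_
    · rw [Finset.mem_coe, Finset.mem_filter, Finset.mem_Ico] at hl
      exact ((h l hl.1.1).resolve_left hl.2).image _
    · rintro x ⟨hxs, hx⟩
      rcases lt_or_ge x m with hxm | hxm
      · exact Or.inl hxm
      · right
        have hdec : m + (x - m) % M + M * ((x - m) / M) = x := by
          rw [add_assoc, Nat.mod_add_div]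
          omega
        have hmem : m + (x - m) % M ∈ Finset.Ico m (m + M) := by
          have := Nat.mod_lt (x - m) hM
          rw [Finset.mem_Ico]
          omega
        simp only [Set.mem_iUnion]
        refine ⟨m + (x - m) % M, ?_, (x - m) / M, ?_, hdec⟩
        · rw [Finset.mem_coe, Finset.mem_filter]
          refine ⟨hmem, fun hall => ?_⟩
          exact hx _ (Finset.mem_filter.2 ⟨hmem, hall⟩) _ hdec.symm
        · rw [Set.mem_ofPred_eq, hdec]
          exact hxs
  -- Each exceptional time `x` is recorded as the constant progression `(0, x)`.
  refine ⟨G.image (fun l => (M, l)) ∪ hB.toFinset.image fun x => (0, x), fun x => ⟨fun hx => ?_,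
    ?_⟩⟩
  · by_cases hxB : x ∈ B
    · exact ⟨(0, x), Finset.mem_union_right _ (Finset.mem_image.2 ⟨x, by simpa using hxB, rfl⟩),
        0, by simp⟩
    · have : ∃ l ∈ G, ∃ n, x = l + M * n := by
        by_contra! hcon
        exact hxB ⟨hx, hcon⟩
      obtain ⟨l, hl, n, rfl⟩ := this
      exact ⟨(M, l), Finset.mem_union_left _ (Finset.mem_image.2 ⟨l, hl, rfl⟩), n, by ring⟩
  · rintro ⟨kl, hkl, n, rfl⟩
    rcases Finset.mem_union.1 hkl with h1 | h1
    · obtain ⟨l, hl, rfl⟩ := Finset.mem_image.1 h1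
      have := (Finset.mem_filter.1 hl).2 n
      rwa [add_comm, mul_comm] at this
    · obtain ⟨x, hx, rfl⟩ := Finset.mem_image.1 h1
      have hxB : x ∈ B := by simpa using hx
      simpa using hxB.1

end Progressions

/-! ### Multihomogeneous equations and products of lines -/

section Multihomogeneous

variable {K : Type*} [Field K]

theorem eval_smul_of_multihomogeneous {g : ℕ} {F : MvPolynomial (Fin g × Fin 2) K} {d : Fin g → ℕ}
    (hF : F.IsWeightedHomogeneous (fun ij : Fin g × Fin 2 => (Pi.single ij.1 1 : Fin g → ℕ)) d)
    (c : Fin g → K) (v : Fin g → Fin 2 → K) :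
    MvPolynomial.eval (fun ij : Fin g × Fin 2 => c ij.1 * v ij.1 ij.2) F
      = (∏ i, c i ^ d i) * MvPolynomial.eval (fun ij : Fin g × Fin 2 => v ij.1 ij.2) F := by
  rw [MvPolynomial.eval_eq', MvPolynomial.eval_eq', Finset.mul_sum]
  refine Finset.sum_congr rfl fun m hm => ?_
  have hd : ∀ i, m (i, 0) + m (i, 1) = d i := by
    intro i
    have h := congrFun (hF (MvPolynomial.mem_support_iff.1 hm)) i
    rw [Finsupp.weight_apply, Finsupp.sum_fintype _ _ (by simp), Finset.sum_apply,
      Fintype.sum_prod_type] at h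
    simpa [Fin.sum_univ_two, Pi.single_apply, Finset.sum_add_distrib] using h
  have h1 : ∏ ij : Fin g × Fin 2, c ij.1 ^ m ij = ∏ i, c i ^ d i := by
    rw [Fintype.prod_prod_type]
    refine Finset.prod_congr rfl fun i _ => ?_
    rw [Fin.prod_univ_two, ← pow_add, hd]
  simp only [mul_pow, Finset.prod_mul_distrib, h1]
  ring

theorem eval_rep_eq_zero_iff {g : ℕ} {F : MvPolynomial (Fin g × Fin 2) K} {d : Fin g → ℕ}
    (hF : F.IsWeightedHomogeneous (fun ij : Fin g × Fin 2 => (Pi.single ij.1 1 : Fin g → ℕ)) d)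
    {P : Fin g → P1 K} {v : Fin g → Fin 2 → K} (hv : ∀ i, IsRep (P i) (v i)) :
    MvPolynomial.eval (fun ij : Fin g × Fin 2 => (P ij.1).rep ij.2) F = 0 ↔
      MvPolynomial.eval (fun ij : Fin g × Fin 2 => v ij.1 ij.2) F = 0 := by
  choose c hc hP using fun i => (hv i).exists_rep_eq
  have h := eval_smul_of_multihomogeneous hF c v
  simp only [hP, Pi.smul_apply, smul_eq_mul]
  rw [h, mul_eq_zero_iff_left]
  exact Finset.prod_ne_zero_iff.2 fun i _ => pow_ne_zero _ (hc i)

end Multihomogeneous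

theorem prodAct_iterate {K : Type*} [Field K] {g : ℕ} (f : Fin g → RatFunc K)
    (P : Fin g → P1 K) (n : ℕ) : (prodAct f)^[n] P = fun i => (act (f i))^[n] (P i) := by
  induction n with
  | zero => rfl
  | succ n ih =>
    rw [Function.iterate_succ_apply', ih]
    ext i
    rw [Function.iterate_succ_apply', prodAct]

theorem DiffBounded.formMap {K : Type*} [NormedField K] [IsUltrametricDist K]
    {A : ValuationSubring K} {ε : ℝ} (hε : 0 ≤ ε) (H : Fin 2 → MvPolynomial (Fin 2) A)
    {v : ℕ → Fin 2 → K} (hv : ∀ i, DiffBounded ε fun n => v n i) (k : ℕ) (i : Fin 2) :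
    DiffBounded ε fun n => (formMap H)^[k] (v n) i := by
  induction k generalizing i with
  | zero => exact hv i
  | succ k ih =>
    have h := DiffBounded.eval hε (MvPolynomial.map (algebraMap A K) (H i))
      (v := fun n => (DynP1.formMap H)^[k] (v n)) ih
    simp only [MvPolynomial.eval_map] at h
    simp only [Function.iterate_succ_apply']
    exact h

/-! ### Interpolation of whole orbits and conclusion -/

section Orbits

variable (p : ℕ) [hp : Fact p.Prime]

theorem padicComplex_natCast_ne_zero : (p : ℂ_[p]) ≠ 0 := Nat.cast_ne_zero.2 hp.out.ne_zero

theorem padicComplex_norm_p_lt_one : ‖(p : ℂ_[p])‖ < 1 := by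
  rw [padicComplex_norm_p]
  exact inv_lt_one_of_one_lt₀ (by exact_mod_cast hp.out.one_lt)

theorem residue_natCast_p : ((p : ℕ) : IsLocalRing.ResidueField 𝓞_ℂ_[p]) = 0 := by
  have h : IsLocalRing.residue 𝓞_ℂ_[p] (p : 𝓞_ℂ_[p]) = 0 := by
    rw [IsLocalRing.residue_eq_zero_iff,
      mem_maximalIdeal_iff_norm_lt_one (mem_padicComplexInt_iff p)]
    simpa using padicComplex_norm_p_lt_one p
  simpa using h

theorem exists_norm_pow_sub_one_lt (a : 𝓞_ℂ_[p]) (ha : ‖(a : ℂ_[p])‖ = 1) :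
    ∃ M > 0, ‖(a : ℂ_[p]) ^ M - 1‖ < 1 := by
  have hA := mem_padicComplexInt_iff p
  have h0 : IsLocalRing.residue 𝓞_ℂ_[p] a ≠ 0 :=
    (IsLocalRing.residue_ne_zero_iff_isUnit _).2 ((isUnit_iff_norm_eq_one hA).2 ha)
  obtain ⟨M, hM, h⟩ := exists_pow_eq_one (residueField_isIntegralElem p) hp.out.ne_zero (residue_natCast_p p) h0
  refine ⟨M, hM, ?_⟩
  rw [← map_pow, ← sub_eq_zero, ← map_one (IsLocalRing.residue _), ← map_sub,
    IsLocalRing.residue_eq_zero_iff, mem_maximalIdeal_iff_norm_lt_one hA] at h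
  simpa using h

/-- The orbit of a point which avoids the residue classes of the attracting periodic points is
eventually interpolated along arithmetic progressions. -/
theorem exists_diffBounded_orbit {f : RatFunc ℂ_[p]} (hf : HasGoodReduction 𝓞_ℂ_[p] f)
    {x : P1 ℂ_[p]} (hx : ∀ z, IsAttractingPeriodic f z → ∀ y ∈ orbit (act f) x,
      ¬ SameResidueClass 𝓞_ℂ_[p] y z) :
    ∃ m M, 0 < M ∧ ∀ k l, m ≤ l → ∃ v : ℕ → Fin 2 → ℂ_[p],
      (∀ i, DiffBounded (‖(p : ℂ_[p])‖ ^ 2) fun n => v n i) ∧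
      ∀ n, IsRep ((act f)^[l + M * k * n] x) (v n) := by
  have hA := mem_padicComplexInt_iff p
  obtain ⟨H, d, hH⟩ := hf.exists_isGoodLift
  obtain ⟨w₀, hw₀, hx₀⟩ := exists_isRep_toVec hA x
  -- Periodicity is obtained for the reduced vector, not only for the reduced point, so `N`
  -- iterations of the lift fix `w` modulo the maximal ideal.
  let φ : 𝓞_ℂ_[p] →ₐ[𝓞_ℂ_[p]] IsLocalRing.ResidueField 𝓞_ℂ_[p] := Algebra.ofId _ _
  obtain ⟨m, N, hN0, hN⟩ := exists_iterate_formMap_eq H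
    (residueField_isIntegralElem p) hp.out.ne_zero (residue_natCast_p p)
    (φ ∘ w₀)
  rw [formMap_iterate_comp_algHom, formMap_iterate_comp_algHom, Nat.add_comm,
    Function.iterate_add_apply] at hN
  set w := (formMap H)^[m] w₀ with hwdef
  have hw : ∃ i, IsUnit (w i) := hH.exists_isUnit_formMap_iterate hw₀ m
  have hP : IsRep ((act f)^[m] x) (toVec w) := by
    rw [hwdef, ← formMap_iterate_toVec]
    exact hH.isRep_act_iterate hx₀ m
  have hN' : ∀ i, ‖(((formMap H)^[N] w i : 𝓞_ℂ_[p]) : ℂ_[p]) - w i‖ < 1 := by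
    intro i
    have h1 : IsLocalRing.residue 𝓞_ℂ_[p] ((formMap H)^[N] w i - w i) = 0 := by
      rw [map_sub, sub_eq_zero]
      exact congrFun hN i
    rw [IsLocalRing.residue_eq_zero_iff, mem_maximalIdeal_iff_norm_lt_one hA] at h1
    simpa using h1
  obtain ⟨M, hM, hMk⟩ := hH.exists_diffBounded_isRep hA hw hP (padicComplex_natCast_ne_zero p)
    (padicComplex_norm_p_lt_one p) hp.out.pos (exists_norm_pow_sub_one_lt p) hN0 hN'
    fun z hz => hx z hz _ ⟨m, rfl⟩
  refine ⟨m, M, hM, fun k l hl => ?_⟩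
  obtain ⟨v, hv, hrep⟩ := hMk k
  -- Applying the forms `l - m` more times moves the starting time from `m` to `l` with the same
  -- difference `M * k`.
  refine ⟨fun n => (formMap H)^[l - m] (v n), fun i => ?_, fun n => ?_⟩
  · exact DiffBounded.formMap (by positivity) H hv (l - m) i
  · have h1 := hH.isRep_act_iterate (hrep n) (l - m)
    rw [← Function.iterate_add_apply, ← Function.iterate_add_apply] at h1
    have h2 : l + M * k * n = l - m + M * k * n + m := by
      rw [Nat.add_right_comm, Nat.sub_add_cancel hl]
    rwa [h2]

end Orbits

end DynP1

theorem theorem3p4 (p : ℕ) [Fact p.Prime] (g : ℕ) (V : Set (Fin g → DynP1.P1 ℂ_[p]))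
    (hV : DynP1.IsSubvariety V) (f : Fin g → RatFunc ℂ_[p])
    (hf : ∀ i, DynP1.HasGoodReduction 𝓞_ℂ_[p] (f i))
    (α : Fin g → DynP1.P1 ℂ_[p])
    (hα : ∀ i, ∀ z : DynP1.P1 ℂ_[p], DynP1.IsAttractingPeriodic (f i) z →
      ∀ y ∈ DynP1.orbit (DynP1.act (f i)) (α i), ¬ DynP1.SameResidueClass 𝓞_ℂ_[p] y z) :
    ∃ T : Finset (ℕ × ℕ),
      V ∩ DynP1.orbit (DynP1.prodAct f) α =
        ⋃ kl ∈ T, {P | ∃ n : ℕ, P = (DynP1.prodAct f)^[n * kl.1 + kl.2] α} := by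
  open DynP1 in
  choose m M hM hseq using fun i => exists_diffBounded_orbit p (hf i) (hα i)
  obtain ⟨S, hS, hVS⟩ := hV
  have hε0 : (0 : ℝ) ≤ ‖(p : ℂ_[p])‖ ^ 2 := by positivity
  -- The sum of the `m i` is a common threshold and the product of the `M i` a common difference;
  -- the free factor `k` in the interpolation makes the latter admissible in each coordinate.
  have hprog : ∀ l, ∑ i, m i ≤ l →
      (∀ n, l + (∏ i, M i) * n ∈ {x | (prodAct f)^[x] α ∈ V}) ∨
        {n | l + (∏ i, M i) * n ∈ {x | (prodAct f)^[x] α ∈ V}}.Finite := by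
    intro l hl
    have hk : ∀ i, ∃ k, ∏ i, M i = M i * k := fun i => Finset.dvd_prod_of_mem M (Finset.mem_univ i)
    choose k hk using hk
    have hml : ∀ i, m i ≤ l := fun i =>
      (Finset.single_le_sum (fun _ _ => Nat.zero_le _) (Finset.mem_univ i)).trans hl
    choose v hv hrep using fun i => hseq i (k i) l (hml i)
    have hmem : ∀ n, l + (∏ i, M i) * n ∈ {x | (prodAct f)^[x] α ∈ V} ↔
        ∀ F ∈ S, MvPolynomial.eval (fun ij : Fin g × Fin 2 => v ij.1 n ij.2) F = 0 := by
      intro n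
      rw [Set.mem_ofPred_eq, hVS, Set.mem_ofPred_eq]
      refine forall₂_congr fun F hF => ?_
      obtain ⟨d, hd⟩ := hS F hF
      refine eval_rep_eq_zero_iff hd (v := fun i => v i n) fun i => ?_
      rw [prodAct_iterate, hk i]
      exact hrep i n
    by_cases hall : ∀ F ∈ S, ∀ n,
        MvPolynomial.eval (fun ij : Fin g × Fin 2 => v ij.1 n ij.2) F = 0
    · exact Or.inl fun n => (hmem n).2 fun F hF => hall F hF n
    · right
      push Not at hall
      obtain ⟨F, hF, n₀, hn₀⟩ := hall
      by_contra hinf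
      refine hn₀ (DiffBounded.eq_zero_of_infinite_zeros
        (fun _ => padicComplex_norm_natCast_eq_one p) (padicComplex_norm_p_lt_one p) hε0 le_rfl
        (DiffBounded.eval hε0 F (v := fun n (ij : Fin g × Fin 2) => v ij.1 n ij.2)
          fun ij => hv ij.1 ij.2) ?_ n₀)
      exact Set.Infinite.mono (fun n hn => (hmem n).1 hn F hF) hinf
  obtain ⟨T, hT⟩ := exists_finset_progressions (Finset.prod_pos fun i _ => hM i) hprog
  refine ⟨T, Set.ext fun P => ?_⟩
  simp only [Set.mem_inter_iff, Set.mem_iUnion, Set.mem_ofPred_eq, exists_prop]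
  constructor
  · rintro ⟨hPV, x, rfl⟩
    obtain ⟨kl, hkl, n, hn⟩ := (hT x).1 hPV
    exact ⟨kl, hkl, n, by rw [← hn]⟩
  · rintro ⟨kl, hkl, n, rfl⟩
    exact ⟨(hT _).2 ⟨kl, hkl, n, rfl⟩, _, rfl⟩
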